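/- **Notation.** A partition of $[-1,1]$ is $\mathbf z=(z_i)_{i=0}^n$ with $-1=z_0<z_1<\dots<z_n=1$; put $z_{-1}:=z_0$, $z_{n+1}:=z_n$ and $\mathcal J_j:=[(z_{j-1}+z_j)/2,\,(z_j+z_{j+1})/2]$ for $0\le j\le n$. Let $\mathcal S_k(\mathbf z)$ be the set of functions on $[-1,1]$ that on each open interval $(z_i,z_{i+1})$ coincide with a polynomial of degree $\le k$, and for $k\ge 1$ let $\widetilde{\mathcal S}_k(\mathbf z):=\mathcal S_k(\mathbf z)\cap C^{k-1}[-1,1]$ (splines of minimal defect). A partition $\mathbf t=(t_i)_{i=0}^m$ of $[-1,1]$ is a $\delta$-remesh of $\mathbf z$ if, for every $0\le j\le n-1$, each interval $[t_i,t_{i+1}]$ that meets $(z_j,z_{j+1})$ has length at most $\delta$ times the smallest of the lengths of $[z_j,z_{j+1}]$ and of the one or two intervals of $\mathbf z$ adjacent to it. Let $\Delta^q$ be the set of $q$-monotone functions on $[-1,1]$, i.e. those for which all divided differences of order $q$ at $q+1$ distinct points of $[-1,1]$ are nonnegative (monotone non-decreasing functions for $q=1$, convex functions for $q=2$). Finally,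 for $0<p\le\infty$ and a closed interval $J$ of length $|J|$, $$\omega_k(f,J)_p:=\sup_{0<h\le |J|}\bigl\|\Delta_h^k(f,\cdot,J)\bigr\|_{L_p(J)},\qquad \Delta_h^k(f,x,J):=\sum_{i=0}^k\binom ki(-1)^{k-i}f\bigl(x-\tfrac{kh}2+ih\bigr)$$ if $x\pm kh/2\in J$, and $\Delta_h^k(f,x,J):=0$ otherwise. **Theorem.** For every integer $r\ge1$ there are a constant $\delta=\delta(r)>0$ and, for every $0<p\le\infty$, a constant $c(p,r)<\infty$ such that the following holds for $q=1$ and $q=2$. For every partition $\mathbf z=(z_i)_{i=0}^n$ of $[-1,1]$, every $s\in\mathcal S_{q+r}(\mathbf z)\cap\Delta^q$ and every $\delta$-remesh $\mathbf t=(t_i)_{i=0}^m$ of $\mathbf z$, there is a spline $\tilde s\in\widetilde{\mathcal S}_{q+r}(\mathbf t)\cap\Delta^q$ such that $$\|s-\tilde s\|_{L_p(\mathcal J_j)}\le c(p,r)\,\omega_{q+r+1}(s,\mathcal J_j)_p,\qquad 0\le j\le n,$$ for all $0<p\le\infty$ simultaneously. -/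

import Mathlib

open MeasureTheory Set
open scoped ENNReal NNReal

namespace SplineSmoothing

noncomputable section

/-- A partition `-1 = z_0 < z_1 < ⋯ < z_n = 1` of `[-1, 1]`. (The two end conditions force
`1 ≤ n`.) -/
structure KnotPartition (n : ℕ) where
  knots : Fin (n + 1) → ℝ
  strictMono : StrictMono knots
  first : knots 0 = -1
  last : knots (Fin.last n) = 1

/-- The knot `z_j`, with the convention `z_j = z_n` for `j > n`. Since subtraction in `ℕ` is
truncated, `z.pt (0 - 1) = z_0`, which is the convention `z_j = z_0` for `j < 0`. -/
def KnotPartition.pt {n : ℕ} (z : KnotPartition n) (j : ℕ) : ℝ :=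
  z.knots ⟨min j n, Nat.lt_succ_of_le (min_le_right j n)⟩

/-- The interval `[(z_{j-1} + z_j) / 2, (z_j + z_{j+1}) / 2]`. -/
def KnotPartition.midInterval {n : ℕ} (z : KnotPartition n) (j : ℕ) : Set ℝ :=
  Icc ((z.pt (j - 1) + z.pt j) / 2) ((z.pt j + z.pt (j + 1)) / 2)

/-- `t` is a `δ`-remesh of `z`: each interval `[t_i, t_{i+1}]` that meets `(z_j, z_{j+1})` has
length at most `δ` times the length of `[z_j, z_{j+1}]` and of each of the (one or two) intervals
of `z` adjacent to it. (The missing neighbours at the two ends count as infinitely long, so they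
impose nothing.) -/
def IsRemesh {n m : ℕ} (δ : ℝ) (z : KnotPartition n) (t : KnotPartition m) : Prop :=
  ∀ j < n, ∀ i < m,
    (Icc (t.pt i) (t.pt (i + 1)) ∩ Ioo (z.pt j) (z.pt (j + 1))).Nonempty →
      ∀ ν < n, ν ≤ j + 1 → j ≤ ν + 1 →
        t.pt (i + 1) - t.pt i ≤ δ * |z.pt (ν + 1) - z.pt ν|

/-- Piecewise polynomial functions of degree `≤ r` with knots `z`: on every open interval
`(z_j, z_{j+1})` the function is a polynomial of degree `≤ r`. Nothing is required at the knots. -/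
def IsPPF {n : ℕ} (r : ℕ) (z : KnotPartition n) (s : ℝ → ℝ) : Prop :=
  ∀ j < n, ∃ P : Polynomial ℝ, P.natDegree ≤ r ∧
    ∀ x ∈ Ioo (z.pt j) (z.pt (j + 1)), s x = P.eval x

/-- Splines of minimal defect of degree `≤ r` with knots `z`: piecewise polynomial functions of
degree `≤ r` that lie in `C^{r-1}[-1, 1]` (no smoothness is required for `r = 0`). -/
def IsSpline {n : ℕ} (r : ℕ) (z : KnotPartition n) (s : ℝ → ℝ) : Prop :=
  IsPPF r z s ∧ ∀ μ : ℕ, μ < r → ContDiffOn ℝ μ s (Icc (-1) 1)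

/-- The divided difference `[f; t_0, …, t_q]` at distinct points `t_0, …, t_q`. -/
def dividedDifference {q : ℕ} (f : ℝ → ℝ) (t : Fin (q + 1) → ℝ) : ℝ :=
  ∑ i, f (t i) / ∏ j ∈ Finset.univ.erase i, (t i - t j)

/-- `f ∈ Δ^q(J)`: all divided differences of order `q` at `q + 1` distinct points of `J` are
nonnegative. -/
def QMonotoneOn (q : ℕ) (f : ℝ → ℝ) (J : Set ℝ) : Prop :=
  ∀ t : Fin (q + 1) → ℝ, Function.Injective t → (∀ i, t i ∈ J) → 0 ≤ dividedDifference f t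

open Classical in
/-- The symmetric difference `Δ_h^k(f, x, J)`, equal to `0` unless both `x - kh/2` and `x + kh/2`
lie in `J`. -/
def symmDifference (k : ℕ) (h : ℝ) (f : ℝ → ℝ) (J : Set ℝ) (x : ℝ) : ℝ :=
  if x - k * h / 2 ∈ J ∧ x + k * h / 2 ∈ J then
    ∑ i ∈ Finset.range (k + 1), (k.choose i : ℝ) * (-1) ^ (k - i) * f (x - k * h / 2 + i * h)
  else 0

/-- The `L_p(J)` (quasi)norm, with values in `[0, ∞]`. -/
def lpNorm (p : ℝ≥0∞) (f : ℝ → ℝ) (J : Set ℝ) : ℝ≥0∞ :=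
  eLpNorm f p (volume.restrict J)

/-- The `k`-th modulus of smoothness `ω_k(f, t, J)_p`. -/
def modulus (k : ℕ) (f : ℝ → ℝ) (t : ℝ) (J : Set ℝ) (p : ℝ≥0∞) : ℝ≥0∞ :=
  ⨆ h ∈ Ioc 0 t, lpNorm p (symmDifference k h f J) J

/-- `ω_k(f, J)_p = ω_k(f, |J|, J)_p`, where `|J|` is the measure of `J`. -/
def modulusOn (k : ℕ) (f : ℝ → ℝ) (J : Set ℝ) (p : ℝ≥0∞) : ℝ≥0∞ :=
  modulus k f (volume.real J) J p

end

end SplineSmoothing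

namespace SplineSmoothing

/-! The smoothing is local. Around each interior knot of `z` take a window whose half-width is half
the shorter adjacent interval; `s` is altered only inside these windows. Scale one window to [-1,
1], with the knot at 0 and polynomials P₋, P₊ on its two sides. Inside the window the distribution
s^(q) is a nonnegative measure: densities p₋ = P₋^(q) and p₊ = P₊^(q), plus a point mass κ ≥ 0 at 0,
the jump of s for q = 1 and of s' for q = 2. It suffices to replace this measure by a nonnegative
spline density of degree r that agrees with p₋ and p₊ at the ends and has the same mass and first
moment. Integrating q times then leads from P₋ exactly to P₊: the mass fixes the derivative of order
q - 1, and for q = 2 the moment fixes the value. This is `exists_local_correction`, followed by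
`exists_local_spline_aux`.

The change of density must be bounded by a multiple of D, where D dominates κ and the coefficients
of p₊ - p₋. If p₋ is at most a multiple of D, both densities are cut down to zero around the knot,
and the lost mass is returned by one bump on each side; the bump coefficients are nonnegative
because they are integrals of a nonnegative defect against nonnegative linear weights. If p₋ is much
larger than D, the density is raised by 2D around the knot, which preserves positivity, and two
bumps of either sign restore the moments at a place where p₋ dominates them. The building blocks
come from a fine mesh by `exists_step`, `exists_bump`, `exists_transition` and
`exists_soft_transition`.

The error in a window is therefore at most a constant times the size of the jump polynomial d = P₊ -
P₋. Conversely, a difference of order q + r + 1 with only its last node beyond the knot equals d at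
that node, so the modulus of smoothness dominates d (`exists_coeffNorm_le_modulusOn`). Both
estimates are pointwise on intervals of comparable length, so they serve all p at once. The windows
do not interfere, and a telescoping sum glues the corrections (`glue_eqOn`, `exists_smoothing`). -/

/-! ### Truncated powers and their span -/

/-- The truncated power `(x - τ)_+^r`. -/
noncomputable def truncPow (r : ℕ) (τ x : ℝ) : ℝ := if τ ≤ x then (x - τ) ^ r else 0

/-- The linear span of the truncated powers of degree `r` with knots in `T`. -/
noncomputable def truncSpan (r : ℕ) (T : Set ℝ) : Submodule ℝ (ℝ → ℝ) :=
  Submodule.span ℝ (truncPow r '' T)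

/-- Monotonicity gives interval integrability for every degree, including the discontinuous case r =
0. -/
theorem truncPow_monotone (r : ℕ) (τ : ℝ) : Monotone (truncPow r τ) := by
  intro x y hxy
  unfold truncPow
  split_ifs with h1 h2 h2
  · exact pow_le_pow_left₀ (by linarith) (by linarith) r
  · linarith
  · exact pow_nonneg (by linarith) r
  · exact le_rfl

theorem integral_truncPow (r : ℕ) {a τ : ℝ} (ha : a ≤ τ) (x : ℝ) :
    ∫ y in a..x, truncPow r τ y = ((r : ℝ) + 1)⁻¹ * truncPow (r + 1) τ x := by
  have hint : ∀ u v, IntervalIntegrable (truncPow r τ) volume u v := fun u v =>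
    (truncPow_monotone r τ).intervalIntegrable
  have hleft : ∀ u ≤ τ, ∫ y in a..u, truncPow r τ y = 0 := by
    intro u hu
    rw [intervalIntegral.integral_congr_uIoo (g := fun _ => (0 : ℝ))]
    · simp
    · intro y hy
      have : y < τ := lt_of_lt_of_le hy.2 (sup_le ha hu)
      simp [truncPow, this]
  have hzero : truncPow (r + 1) τ τ = 0 := by simp [truncPow]
  rcases le_total x τ with hx | hx
  · rw [hleft x hx]
    rcases hx.lt_or_eq with h | h
    · simp [truncPow, h]
    · rw [h, hzero, mul_zero]
  · rw [← intervalIntegral.integral_add_adjacent_intervals (hint a τ) (hint τ x),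
      hleft τ le_rfl, zero_add,
      intervalIntegral.integral_congr_Ioo_of_le (g := fun y => (y - τ) ^ r) hx]
    · rw [intervalIntegral.integral_comp_sub_right (fun y => y ^ r) τ, integral_pow]
      simp [truncPow, hx]
      ring
    · intro y hy
      simp [truncPow, hy.1.le]

theorem truncSpan_mono {r : ℕ} {S T : Set ℝ} (h : S ⊆ T) : truncSpan r S ≤ truncSpan r T :=
  Submodule.span_mono (image_mono h)

theorem truncSpan_induction {r : ℕ} {T : Set ℝ} {M : (ℝ → ℝ) → Prop}
    (hpow : ∀ τ ∈ T, M (truncPow r τ)) (hzero : M 0) (hadd : ∀ f g, M f → M g → M (f + g))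
    (hsmul : ∀ (c : ℝ) f, M f → M (c • f)) {v : ℝ → ℝ} (hv : v ∈ truncSpan r T) : M v := by
  refine Submodule.span_induction (p := fun f _ => M f) ?_ hzero (fun f g _ _ => hadd f g)
    (fun c f _ => hsmul c f) hv
  rintro _ ⟨τ, hτ, rfl⟩
  exact hpow τ hτ

theorem truncSpan_eq_zero {r : ℕ} {T : Set ℝ} {a : ℝ} (hT : T ⊆ Ioi a) {v : ℝ → ℝ}
    (hv : v ∈ truncSpan r T) : ∀ x ≤ a, v x = 0 := by
  refine truncSpan_induction (M := fun v => ∀ x ≤ a, v x = 0) ?_ ?_ ?_ ?_ hv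
  · intro τ hτ x hx
    simp [truncPow, lt_of_le_of_lt hx (hT hτ)]
  · simp
  · intro f g hf hg x hx
    simp [hf x hx, hg x hx]
  · intro c f hf x hx
    simp [hf x hx]

theorem truncSpan_intervalIntegrable {r : ℕ} {T : Set ℝ} {v : ℝ → ℝ}
    (hv : v ∈ truncSpan r T) : ∀ a b, IntervalIntegrable v volume a b := by
  refine truncSpan_induction (M := fun v => ∀ a b, IntervalIntegrable v volume a b) ?_ ?_ ?_ ?_ hv
  · intro τ hτ a b
    exact (truncPow_monotone r τ).intervalIntegrable
  · intro a b
    exact intervalIntegrable_const (c := (0 : ℝ))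
  · intro f g hf hg a b
    exact (hf a b).add (hg a b)
  · intro c f hf a b
    exact (hf a b).const_mul c

/-- The base point lies to the left of every knot, so integration raises the degree without
producing a constant. Integrability is carried through the induction because additivity of the
integral needs it. -/
theorem primitive_mem_truncSpan {r : ℕ} {T : Set ℝ} {a : ℝ} (hT : T ⊆ Ioi a) {v : ℝ → ℝ}
    (hv : v ∈ truncSpan r T) : (fun x => ∫ y in a..x, v y) ∈ truncSpan (r + 1) T := by
  have key : (∀ u w, IntervalIntegrable v volume u w) ∧
      (fun x => ∫ y in a..x, v y) ∈ truncSpan (r + 1) T := by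
    refine truncSpan_induction (M := fun v => (∀ u w, IntervalIntegrable v volume u w) ∧
      (fun x => ∫ y in a..x, v y) ∈ truncSpan (r + 1) T) ?_ ?_ ?_ ?_ hv
    · intro τ hτ
      refine ⟨fun u w => (truncPow_monotone r τ).intervalIntegrable, ?_⟩
      have : (fun x => ∫ y in a..x, truncPow r τ y) =
          ((r : ℝ) + 1)⁻¹ • truncPow (r + 1) τ := by
        ext x
        simpa using integral_truncPow r (hT hτ).le x
      rw [this]
      exact Submodule.smul_mem _ _ (Submodule.subset_span ⟨τ, hτ, rfl⟩)
    · refine ⟨fun u w => intervalIntegrable_const (c := (0 : ℝ)), ?_⟩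
      simp only [Pi.zero_apply, intervalIntegral.integral_zero]
      exact Submodule.zero_mem _
    · rintro f g ⟨hf, hf'⟩ ⟨hg, hg'⟩
      refine ⟨fun u w => (hf u w).add (hg u w), ?_⟩
      have : (fun x => ∫ y in a..x, (f + g) y) =
          (fun x => ∫ y in a..x, f y) + fun x => ∫ y in a..x, g y := by
        ext x
        exact intervalIntegral.integral_add (hf a x) (hg a x)
      rw [this]
      exact Submodule.add_mem _ hf' hg'
    · rintro c f ⟨hf, hf'⟩
      refine ⟨fun u w => (hf u w).const_mul c, ?_⟩
      have : (fun x => ∫ y in a..x, (c • f) y) = c • (fun x => ∫ y in a..x, f y) := by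
        ext x
        simp
      rw [this]
      exact Submodule.smul_mem _ _ hf'
  exact key.2

theorem truncPow_continuous {r : ℕ} (hr : 1 ≤ r) (τ : ℝ) : Continuous (truncPow r τ) := by
  have : truncPow r τ = fun x => (max (x - τ) 0) ^ r := by
    ext x
    unfold truncPow
    split_ifs with h
    · rw [max_eq_left (by linarith)]
    · rw [max_eq_right (by linarith), zero_pow (by omega)]
  rw [this]
  fun_prop

theorem truncPow_hasDerivAt {r : ℕ} (hr : 1 ≤ r) (τ x : ℝ) :
    HasDerivAt (truncPow (r + 1) τ) (((r : ℝ) + 1) * truncPow r τ x) x := by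
  have h := (intervalIntegral.integral_hasDerivAt_right
    ((truncPow_monotone r τ).intervalIntegrable (a := τ) (b := x))
    ((truncPow_continuous hr τ).stronglyMeasurableAtFilter _ _)
    (truncPow_continuous hr τ).continuousAt).const_mul ((r : ℝ) + 1)
  refine h.congr_of_eventuallyEq (Filter.Eventually.of_forall fun u => ?_)
  have hr' : (r : ℝ) + 1 ≠ 0 := by positivity
  simp only [integral_truncPow r le_rfl u]
  field_simp

theorem truncPow_contDiff (r : ℕ) (τ : ℝ) : ContDiff ℝ r (truncPow (r + 1) τ) := by
  induction r with
  | zero => exact contDiff_zero.2 (truncPow_continuous le_rfl τ)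
  | succ r ih =>
    have hd : ∀ x, HasDerivAt (truncPow (r + 1 + 1) τ)
        (((r + 1 : ℕ) + 1 : ℝ) * truncPow (r + 1) τ x) x := fun x =>
      truncPow_hasDerivAt (by omega) τ x
    have : deriv (truncPow (r + 1 + 1) τ) =
        fun x => ((r + 1 : ℕ) + 1 : ℝ) * truncPow (r + 1) τ x := funext fun x => (hd x).deriv
    push_cast
    rw [contDiff_succ_iff_deriv]
    refine ⟨fun x => (hd x).differentiableAt, by simp, ?_⟩
    rw [this]
    exact contDiff_const.mul ih

theorem truncSpan_contDiff {r : ℕ} {T : Set ℝ} {v : ℝ → ℝ} (hv : v ∈ truncSpan (r + 1) T) :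
    ContDiff ℝ r v := by
  refine truncSpan_induction (M := fun v => ContDiff ℝ r v) ?_ ?_ ?_ ?_ hv
  · intro τ _
    exact truncPow_contDiff r τ
  · exact contDiff_const
  · intro f g hf hg
    exact hf.add hg
  · intro c f hf
    exact contDiff_const.smul hf

theorem truncSpan_continuous {r : ℕ} (hr : 1 ≤ r) {T : Set ℝ} {v : ℝ → ℝ}
    (hv : v ∈ truncSpan r T) : Continuous v := by
  obtain ⟨k, rfl⟩ := Nat.exists_eq_add_of_le' hr
  exact (truncSpan_contDiff hv).continuous

/-- Rescaling of truncated powers. -/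
theorem truncSpan_comp_affine {r : ℕ} {S T : Set ℝ} {a z : ℝ} (ha : 0 < a)
    (hST : ∀ τ ∈ S, z + a * τ ∈ T) {v : ℝ → ℝ} (hv : v ∈ truncSpan r S) :
    (fun x => v ((x - z) / a)) ∈ truncSpan r T := by
  refine truncSpan_induction (M := fun v => (fun x => v ((x - z) / a)) ∈ truncSpan r T)
    ?_ ?_ ?_ ?_ hv
  · intro τ hτ
    have : (fun x => truncPow r τ ((x - z) / a)) = (a ^ r)⁻¹ • truncPow r (z + a * τ) := by
      ext x
      have h1 : τ ≤ (x - z) / a ↔ z + a * τ ≤ x := by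
        rw [le_div_iff₀ ha]
        constructor <;> intro h <;> linarith
      simp only [truncPow, h1, Pi.smul_apply, smul_eq_mul]
      split_ifs
      · rw [eq_inv_mul_iff_mul_eq₀ (by positivity), ← mul_pow]
        congr 1
        field_simp
        ring
      · simp
    rw [this]
    exact Submodule.smul_mem _ _ (Submodule.subset_span ⟨_, hST τ hτ, rfl⟩)
  · exact Submodule.zero_mem _
  · intro f g hf hg
    exact Submodule.add_mem _ hf hg
  · intro c f hf
    exact Submodule.smul_mem _ c hf

/-! ### A coefficient norm on polynomials -/

/-- The `ℓ¹` norm of the coefficients of index `≤ r`. -/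
noncomputable def coeffNorm (r : ℕ) (p : Polynomial ℝ) : ℝ :=
  ∑ i ∈ Finset.range (r + 1), |p.coeff i|

theorem coeffNorm_nonneg (r : ℕ) (p : Polynomial ℝ) : 0 ≤ coeffNorm r p :=
  Finset.sum_nonneg fun _ _ => abs_nonneg _

theorem coeffNorm_add_le (r : ℕ) (p q : Polynomial ℝ) :
    coeffNorm r (p + q) ≤ coeffNorm r p + coeffNorm r q := by
  unfold coeffNorm
  rw [← Finset.sum_add_distrib]
  refine Finset.sum_le_sum fun i _ => ?_
  rw [Polynomial.coeff_add]
  exact abs_add_le _ _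

theorem coeffNorm_C_mul (r : ℕ) (c : ℝ) (p : Polynomial ℝ) :
    coeffNorm r (Polynomial.C c * p) = |c| * coeffNorm r p := by
  simp [coeffNorm, abs_mul, Finset.mul_sum]

theorem coeffNorm_neg (r : ℕ) (p : Polynomial ℝ) : coeffNorm r (-p) = coeffNorm r p := by
  simp [coeffNorm]

theorem coeffNorm_sub_le (r : ℕ) (p q : Polynomial ℝ) :
    coeffNorm r (p - q) ≤ coeffNorm r p + coeffNorm r q := by
  rw [sub_eq_add_neg, ← coeffNorm_neg r q]
  exact coeffNorm_add_le r p (-q)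

theorem coeffNorm_C (r : ℕ) (c : ℝ) : coeffNorm r (Polynomial.C c) = |c| := by
  unfold coeffNorm
  rw [Finset.sum_eq_single_of_mem 0 (by simp)]
  · simp
  · intro i _ hi
    simp [Polynomial.coeff_C, hi]

theorem coeffNorm_sum_le (r : ℕ) {ι : Type*} (s : Finset ι) (p : ι → Polynomial ℝ) :
    coeffNorm r (∑ i ∈ s, p i) ≤ ∑ i ∈ s, coeffNorm r (p i) := by
  classical
  induction s using Finset.induction_on with
  | empty => simp [coeffNorm]
  | insert a s ha ih =>
    rw [Finset.sum_insert ha, Finset.sum_insert ha]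
    exact (coeffNorm_add_le _ _ _).trans (by linarith)

theorem coeffNorm_derivative_le (r : ℕ) (p : Polynomial ℝ) :
    coeffNorm r p.derivative ≤ ((r : ℝ) + 1) * coeffNorm (r + 1) p := by
  unfold coeffNorm
  rw [Finset.sum_range_succ' _ (r + 1), mul_add, Finset.mul_sum]
  refine le_add_of_le_of_nonneg (Finset.sum_le_sum fun i hi => ?_) (by positivity)
  rw [Polynomial.coeff_derivative, abs_mul, mul_comm]
  have h : |(i : ℝ) + 1| ≤ (r : ℝ) + 1 := by
    rw [abs_of_nonneg (by positivity)]
    have : i ≤ r := by simpa [Nat.lt_succ_iff] using hi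
    have : (i : ℝ) ≤ r := by exact_mod_cast this
    linarith
  exact mul_le_mul_of_nonneg_right h (abs_nonneg _)

theorem abs_eval_le_coeffNorm {r : ℕ} {p : Polynomial ℝ} (hp : p.natDegree ≤ r) {x : ℝ}
    (hx : |x| ≤ 1) : |p.eval x| ≤ coeffNorm r p := by
  rw [Polynomial.eval_eq_sum_range' (Nat.lt_succ_of_le hp)]
  refine (Finset.abs_sum_le_sum_abs _ _).trans (Finset.sum_le_sum fun i _ => ?_)
  rw [abs_mul, abs_pow]
  exact mul_le_of_le_one_right (abs_nonneg _) (pow_le_one₀ (abs_nonneg _) hx)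

theorem natDegree_derivative_le_of_le {r : ℕ} {p : Polynomial ℝ} (hp : p.natDegree ≤ r + 1) :
    p.derivative.natDegree ≤ r :=
  (Polynomial.natDegree_derivative_le p).trans (by omega)

theorem coeffNorm_derivative_le_self {r : ℕ} {p : Polynomial ℝ} (hp : p.natDegree ≤ r) :
    coeffNorm r p.derivative ≤ (r : ℝ) * coeffNorm r p := by
  cases r with
  | zero =>
    rw [Polynomial.eq_C_of_natDegree_le_zero hp]
    simp [coeffNorm]
  | succ r =>
    have h : p.derivative.coeff (r + 1) = 0 :=
      Polynomial.coeff_eq_zero_of_natDegree_lt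
        (Nat.lt_succ_of_le (natDegree_derivative_le_of_le hp))
    have := coeffNorm_derivative_le r p
    have h2 : coeffNorm (r + 1) p.derivative = coeffNorm r p.derivative := by
      unfold coeffNorm
      rw [Finset.sum_range_succ _ (r + 1), h]
      simp
    rw [h2]
    exact_mod_cast this

theorem abs_eval_sub_le {r : ℕ} {p : Polynomial ℝ} (hp : p.natDegree ≤ r) {x y : ℝ}
    (hx : x ∈ Icc (-1 : ℝ) 1) (hy : y ∈ Icc (-1 : ℝ) 1) :
    |p.eval y - p.eval x| ≤ r * coeffNorm r p * |y - x| := by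
  have h := (convex_Icc (-1 : ℝ) 1).norm_image_sub_le_of_norm_hasDerivWithin_le
    (f := fun x => p.eval x) (f' := fun x => p.derivative.eval x) (C := r * coeffNorm r p)
    (fun x _ => (p.hasDerivAt x).hasDerivWithinAt) (fun u hu => ?_) hx hy
  · simpa [Real.norm_eq_abs] using h
  · rw [Real.norm_eq_abs]
    exact (abs_eval_le_coeffNorm
      ((Polynomial.natDegree_derivative_le p).trans (by omega)) (abs_le.2 hu)).trans
      (coeffNorm_derivative_le_self hp)

/-- On any fixed interval a polynomial is somewhere as large as its coefficients. -/
theorem exists_coeffNorm_le_abs_eval (r : ℕ) {α β : ℝ} (hαβ : α < β) :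
    ∃ c : ℝ, 0 < c ∧ ∀ p : Polynomial ℝ, p.natDegree ≤ r →
      ∃ x ∈ Icc α β, c * coeffNorm r p ≤ |p.eval x| := by
  classical
  let s := Finset.range (r + 1)
  -- A polynomial of degree ≤ r is recovered from its values at r + 1 nodes, so its coefficients are
  -- at most `M` times the largest nodal value. The `+ 1` in the final constant only guards against
  -- dividing by zero.
  let node : ℕ → ℝ := fun i => α + (β - α) * (i / (r + 1))
  have hr : (0 : ℝ) < r + 1 := by positivity
  have hinj : Set.InjOn node s := by
    intro i _ j _ hij
    have h1 : (β - α) * ((i : ℝ) / (r + 1)) = (β - α) * (j / (r + 1)) := by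
      simpa [node] using hij
    have h2 := mul_left_cancel₀ (sub_pos.2 hαβ).ne' h1
    have h3 := (div_left_inj' hr.ne').1 h2
    exact_mod_cast h3
  have hnode : ∀ i ∈ s, node i ∈ Icc α β := by
    intro i hi
    have h0 : (0 : ℝ) ≤ (i : ℝ) / (r + 1) := by positivity
    have h1 : (i : ℝ) / (r + 1) ≤ 1 := by
      rw [div_le_one hr]
      have : i < r + 1 := by simpa [s] using hi
      exact_mod_cast this.le
    have hd := sub_pos.2 hαβ
    constructor <;> simp only [node] <;> nlinarith
  let M := ∑ i ∈ s, coeffNorm r (Lagrange.basis s node i)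
  have hM : 0 ≤ M := Finset.sum_nonneg fun _ _ => coeffNorm_nonneg _ _
  refine ⟨(M + 1)⁻¹, by positivity, fun p hp => ?_⟩
  obtain ⟨i, hi, hmax⟩ := Finset.exists_max_image s (fun i => |p.eval (node i)|) ⟨0, by simp [s]⟩
  refine ⟨node i, hnode i hi, ?_⟩
  have heq : p = Lagrange.interpolate s node (fun i => p.eval (node i)) := by
    refine Lagrange.eq_interpolate hinj ?_
    refine lt_of_le_of_lt Polynomial.degree_le_natDegree ?_
    have : p.natDegree < s.card := by simpa [s, Nat.lt_succ_iff] using hp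
    exact_mod_cast this
  have hb : coeffNorm r p ≤ M * |p.eval (node i)| := by
    conv_lhs => rw [heq]
    rw [Lagrange.interpolate_apply, Finset.sum_mul]
    refine (coeffNorm_sum_le r s _).trans (Finset.sum_le_sum fun j hj => ?_)
    rw [coeffNorm_C_mul, mul_comm]
    exact mul_le_mul_of_nonneg_left (hmax j hj) (coeffNorm_nonneg _ _)
  rw [inv_mul_le_iff₀ (by positivity)]
  nlinarith [abs_nonneg (p.eval (node i))]

/-! ### Steps and bumps on a fine mesh -/

/-- Every open subinterval of `[-1, 1]` of length `δ` meets `T`. -/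
def MeshDense (δ : ℝ) (T : Set ℝ) : Prop :=
  ∀ x, -1 ≤ x → x + δ ≤ 1 → ∃ τ ∈ T, τ ∈ Ioo x (x + δ)

/-- A spline of degree `r` rising from `0` to `1` within `(a, b)`. -/
def IsStep (r : ℕ) (T : Set ℝ) (a b : ℝ) (σ : ℝ → ℝ) : Prop :=
  σ ∈ truncSpan r (T ∩ Ioo a b) ∧ (∀ x, b ≤ x → σ x = 1) ∧ ∀ x, 0 ≤ σ x ∧ σ x ≤ 1

/-- A nonnegative spline of degree `r` and of unit mass, supported in `(a, b)`. -/
structure IsBump (r : ℕ) (T : Set ℝ) (a b : ℝ) (g : ℝ → ℝ) : Prop where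
  mem : g ∈ truncSpan r (T ∩ Ioo a b)
  right : ∀ x, b ≤ x → g x = 0
  nonneg : ∀ x, 0 ≤ g x
  le : ∀ x, g x ≤ 3 / (b - a)
  mass : ∫ x in (-1 : ℝ)..1, g x = 1
  moment : (∫ x in (-1 : ℝ)..1, x * g x) ∈ Icc a b

theorem inter_Ioo_subset_Ioi (T : Set ℝ) (a b : ℝ) : T ∩ Ioo a b ⊆ Ioi a := fun _ h => h.2.1

theorem inter_Ioo_subset_inter_Ioo (T : Set ℝ) {a b a' b' : ℝ} (ha : a' ≤ a) (hb : b ≤ b') :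
    T ∩ Ioo a b ⊆ T ∩ Ioo a' b' :=
  inter_subset_inter_right _ (Ioo_subset_Ioo ha hb)

theorem IsStep.left {r : ℕ} {T : Set ℝ} {a b : ℝ} {σ : ℝ → ℝ} (h : IsStep r T a b σ) :
    ∀ x ≤ a, σ x = 0 :=
  truncSpan_eq_zero (inter_Ioo_subset_Ioi T a b) h.1

theorem IsBump.left {r : ℕ} {T : Set ℝ} {a b : ℝ} {g : ℝ → ℝ} (h : IsBump r T a b g) :
    ∀ x ≤ a, g x = 0 :=
  truncSpan_eq_zero (inter_Ioo_subset_Ioi T a b) h.mem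

theorem integral_eq_of_eq_zero_right {g : ℝ → ℝ} (hg : ∀ u w, IntervalIntegrable g volume u w)
    {b x y : ℝ} (h0 : ∀ x, b ≤ x → g x = 0) (hx : b ≤ x) (hy : b ≤ y) (a : ℝ) :
    ∫ t in a..x, g t = ∫ t in a..y, g t := by
  have key : ∫ t in x..y, g t = 0 := by
    rw [intervalIntegral.integral_congr (g := fun _ => (0 : ℝ))]
    · simp
    · intro t ht
      exact h0 t ((le_min hx hy).trans ht.1)
  rw [← intervalIntegral.integral_add_adjacent_intervals (hg a x) (hg x y), key, add_zero]

/-- Subtract a step in the last third from a step in the first third. The result lies in [0, 1] and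
equals 1 on the middle third, so its mass is at least (b - a)/3; normalising by the mass gives the
height bound 3/(b - a). -/
theorem exists_bump_of_steps {r : ℕ} {T : Set ℝ} {a b : ℝ} (ha : -1 ≤ a) (hb : b ≤ 1)
    (hab : a < b) {σ₁ σ₃ : ℝ → ℝ} (h₁ : IsStep r T a (a + (b - a) / 3) σ₁)
    (h₃ : IsStep r T (a + 2 * (b - a) / 3) b σ₃) : ∃ g, IsBump r T a b g := by
  set f : ℝ → ℝ := σ₁ - σ₃ with hf
  have hmem : f ∈ truncSpan r (T ∩ Ioo a b) :=
    Submodule.sub_mem _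
      (truncSpan_mono (inter_Ioo_subset_inter_Ioo T le_rfl (by linarith)) h₁.1)
      (truncSpan_mono (inter_Ioo_subset_inter_Ioo T (by linarith) le_rfl) h₃.1)
  have hint := truncSpan_intervalIntegrable hmem
  have hright : ∀ x, b ≤ x → f x = 0 := fun x hx => by
    simp [hf, h₁.2.1 x (by linarith), h₃.2.1 x hx]
  have hleft : ∀ x ≤ a, f x = 0 := truncSpan_eq_zero (inter_Ioo_subset_Ioi T a b) hmem
  have hnonneg : ∀ x, 0 ≤ f x := fun x => by
    rcases le_total x (a + 2 * (b - a) / 3) with hx | hx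
    · simp [hf, h₃.left x hx, (h₁.2.2 x).1]
    · simp [hf, h₁.2.1 x (by linarith), (h₃.2.2 x).2]
  have hle : ∀ x, f x ≤ 1 := fun x => by
    have := (h₁.2.2 x).2
    have := (h₃.2.2 x).1
    simp only [hf, Pi.sub_apply]
    linarith
  set m := ∫ x in (-1 : ℝ)..1, f x with hm
  have hmass : (b - a) / 3 ≤ m := by
    have h1 : ∫ x in (a + (b - a) / 3)..(a + 2 * (b - a) / 3), f x ≤ m :=
      intervalIntegral.integral_mono_interval (by linarith) (by linarith) (by linarith)
        (Filter.Eventually.of_forall hnonneg) (hint _ _)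
    rw [intervalIntegral.integral_congr (g := fun _ => (1 : ℝ))] at h1
    · simp only [intervalIntegral.integral_const, smul_eq_mul, mul_one] at h1
      linarith
    · intro x hx
      rw [uIcc_of_le (by linarith)] at hx
      simp [hf, h₁.2.1 x hx.1, h₃.left x hx.2]
  have hm0 : 0 < m := by linarith
  have hg : ∀ x, (m⁻¹ • f) x = m⁻¹ * f x := fun x => rfl
  have hgint := truncSpan_intervalIntegrable (Submodule.smul_mem _ m⁻¹ hmem)
  have hgnn : ∀ x, 0 ≤ (m⁻¹ • f) x := fun x => mul_nonneg (by positivity) (hnonneg x)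
  have hgm : ∫ x in (-1 : ℝ)..1, (m⁻¹ • f) x = 1 := by
    simp only [hg, intervalIntegral.integral_const_mul]
    exact inv_mul_cancel₀ hm0.ne'
  have hxint : IntervalIntegrable (fun x => x * (m⁻¹ • f) x) volume (-1) 1 :=
    (hgint (-1) 1).continuousOn_mul continuousOn_id
  refine ⟨m⁻¹ • f, Submodule.smul_mem _ _ hmem, fun x hx => by simp [hright x hx], hgnn,
    fun x => ?_, hgm, ?_, ?_⟩
  · rw [hg, inv_mul_le_iff₀ hm0]
    calc f x ≤ 1 := hle x
      _ = (b - a) / 3 * (3 / (b - a)) := by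
        have : b - a ≠ 0 := by linarith
        field_simp
      _ ≤ m * (3 / (b - a)) :=
        mul_le_mul_of_nonneg_right hmass (div_nonneg (by norm_num) (by linarith))
  · have := intervalIntegral.integral_mono_on (by norm_num) ((hgint (-1) 1).const_mul a) hxint
      (fun x _ => by
        rcases le_total x a with h | h
        · simp [hleft x h]
        · exact mul_le_mul_of_nonneg_right h (hgnn x))
    rwa [intervalIntegral.integral_const_mul, hgm, mul_one] at this
  · have := intervalIntegral.integral_mono_on (by norm_num) hxint ((hgint (-1) 1).const_mul b)
      (fun x _ => by
        rcases le_total x b with h | h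
        · exact mul_le_mul_of_nonneg_right h (hgnn x)
        · simp [hright x h])
    rwa [intervalIntegral.integral_const_mul, hgm, mul_one] at this

/-- The distribution function of a probability density supported in (a, b) rises from 0 to 1 there;
this gains one degree. -/
theorem IsBump.isStep {r : ℕ} {T : Set ℝ} {a b : ℝ} {g : ℝ → ℝ} (ha : -1 ≤ a) (hb : b ≤ 1)
    (h : IsBump r T a b g) : IsStep (r + 1) T a b (fun x => ∫ y in (-1 : ℝ)..x, g y) := by
  have hint := truncSpan_intervalIntegrable h.mem
  have hsub : T ∩ Ioo a b ⊆ Ioi (-1) := (inter_Ioo_subset_Ioi T a b).trans (Ioi_subset_Ioi ha)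
  have hmem := primitive_mem_truncSpan hsub h.mem
  have hone : ∀ x, b ≤ x → ∫ y in (-1 : ℝ)..x, g y = 1 := fun x hx => by
    exact (integral_eq_of_eq_zero_right hint h.right hx hb _).trans h.mass
  refine ⟨hmem, hone, fun x => ⟨?_, ?_⟩⟩
  · rcases le_total x (-1) with hx | hx
    · exact (truncSpan_eq_zero hsub hmem x hx).ge
    · exact intervalIntegral.integral_nonneg hx fun y _ => h.nonneg y
  · rcases le_total x (-1) with hx | hx
    · exact (truncSpan_eq_zero hsub hmem x hx).trans_le zero_le_one
    · rcases le_total x 1 with hx1 | hx1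
      · exact (intervalIntegral.integral_mono_interval le_rfl hx hx1
          (Filter.Eventually.of_forall h.nonneg) (hint _ _)).trans_eq h.mass
      · exact (hone x (hb.trans hx1)).le

/-- In degree 0 a single knot suffices. A step of the next degree is the primitive of a bump made of
two steps, each confined to a third of the interval, so every degree triples the required length. -/
theorem exists_step {δ : ℝ} (hδ : 0 < δ) {T : Set ℝ} (hT : MeshDense δ T) (r : ℕ) :
    ∀ a b : ℝ, -1 ≤ a → b ≤ 1 → 3 ^ r * δ ≤ b - a → ∃ σ, IsStep r T a b σ := by
  induction r with
  | zero =>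
    intro a b ha hb hab
    rw [pow_zero, one_mul] at hab
    obtain ⟨τ, hτT, hτ⟩ := hT a ha (by linarith)
    have hτb : τ < b := by linarith [hτ.2]
    refine ⟨truncPow 0 τ, Submodule.subset_span ⟨τ, ⟨hτT, hτ.1, hτb⟩, rfl⟩, fun x hx => ?_,
      fun x => ?_⟩
    · simp [truncPow, hτb.le.trans hx]
    · unfold truncPow
      split_ifs <;> simp
  | succ r ih =>
    intro a b ha hb hab
    rw [pow_succ] at hab
    have h0 : 0 < (3 : ℝ) ^ r * δ := by positivity
    obtain ⟨σ₁, h₁⟩ := ih a (a + (b - a) / 3) ha (by linarith) (by linarith)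
    obtain ⟨σ₃, h₃⟩ := ih (a + 2 * (b - a) / 3) b (by linarith) hb (by linarith)
    obtain ⟨g, hg⟩ := exists_bump_of_steps ha hb (by linarith) h₁ h₃
    exact ⟨_, hg.isStep ha hb⟩

theorem exists_bump {δ : ℝ} (hδ : 0 < δ) {T : Set ℝ} (hT : MeshDense δ T) (r : ℕ) {a b : ℝ}
    (ha : -1 ≤ a) (hb : b ≤ 1) (hab : 3 ^ (r + 1) * δ ≤ b - a) : ∃ g, IsBump r T a b g := by
  rw [pow_succ] at hab
  have h0 : 0 < (3 : ℝ) ^ r * δ := by positivity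
  obtain ⟨σ₁, h₁⟩ := exists_step hδ hT r a (a + (b - a) / 3) ha (by linarith) (by linarith)
  obtain ⟨σ₃, h₃⟩ := exists_step hδ hT r (a + 2 * (b - a) / 3) b (by linarith) hb (by linarith)
  exact exists_bump_of_steps ha hb (by linarith) h₁ h₃

/-! ### Transitions from zero to a polynomial -/

/-- Spline transition from `0` to a polynomial `e` within `(a, b)`. -/
theorem exists_transition (r : ℕ) : ∃ C : ℝ, 0 ≤ C ∧ ∀ (δ : ℝ) (T : Set ℝ), 0 < δ →
    MeshDense δ T → ∀ (a b : ℝ), -1 ≤ a → b ≤ 1 → 3 ^ r * δ ≤ b - a →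
    ∀ e : Polynomial ℝ, e.natDegree ≤ r →
    ∃ v ∈ truncSpan r (T ∩ Ioo a b), (∀ x, b ≤ x → v x = e.eval x) ∧
      ∀ x ≤ b, |v x| ≤ |e.eval b| + C * (b - a) * coeffNorm r e := by
  induction r with
  | zero =>
    refine ⟨0, le_rfl, fun δ T hδ hT a b ha hb hab e he => ?_⟩
    obtain ⟨σ, hσ⟩ := exists_step hδ hT 0 a b ha hb hab
    obtain ⟨c, rfl⟩ : ∃ c, e = Polynomial.C c := ⟨_, Polynomial.eq_C_of_natDegree_le_zero he⟩
    refine ⟨c • σ, Submodule.smul_mem _ _ hσ.1, fun x hx => by simp [hσ.2.1 x hx], fun x _ => ?_⟩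
    have h := hσ.2.2 x
    simp only [Pi.smul_apply, smul_eq_mul, Polynomial.eval_C, abs_mul, zero_mul, add_zero]
    rw [abs_of_nonneg h.1]
    exact mul_le_of_le_one_right (abs_nonneg _) h.2
  | succ r ih =>
    obtain ⟨C, hC, hv⟩ := ih
    -- `K * N` will bound a transition to e': combine |e'(b)| ≤ ‖e'‖, b - a ≤ 2 and ‖e'‖ ≤ (r +
    -- 1)‖e‖.
    set K : ℝ := (1 + 2 * C) * (r + 1) with hK
    have hK0 : 0 ≤ K := by positivity
    refine ⟨2 * K, by positivity, fun δ T hδ hT a b ha hb hab e he => ?_⟩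
    have h3 : (3 : ℝ) ^ r * δ ≤ 3 ^ (r + 1) * δ := by
      gcongr <;> norm_num
    have hab0 : 0 < b - a := lt_of_lt_of_le (by positivity) hab
    have hde := natDegree_derivative_le_of_le he
    obtain ⟨w, hwmem, hwr, hwb⟩ := hv δ T hδ hT a b ha hb (h3.trans hab) e.derivative hde
    obtain ⟨σ, hσ⟩ := exists_step hδ hT (r + 1) a b ha hb hab
    set N := coeffNorm (r + 1) e with hN
    have hN0 : 0 ≤ N := coeffNorm_nonneg _ _
    have hwle : ∀ x ≤ b, |w x| ≤ K * N := fun x hx => by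
      refine (hwb x hx).trans ?_
      have h1 := abs_eval_le_coeffNorm hde (x := b) (abs_le.2 ⟨by linarith, hb⟩)
      have h2 := coeffNorm_derivative_le r e
      have h4 : 0 ≤ coeffNorm r e.derivative := coeffNorm_nonneg _ _
      have h5 : C * (b - a) * coeffNorm r e.derivative ≤ C * 2 * coeffNorm r e.derivative := by
        gcongr
        linarith
      have h6 : (1 + 2 * C) * coeffNorm r e.derivative ≤ (1 + 2 * C) * ((r + 1) * N) := by
        gcongr
      rw [hK]
      linarith
    have hint := truncSpan_intervalIntegrable hwmem
    have hsub := inter_Ioo_subset_Ioi T a b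
    have hVmem := primitive_mem_truncSpan hsub hwmem
    set V : ℝ → ℝ := fun x => ∫ y in a..x, w y with hV
    have hVle : ∀ x ≤ b, |V x| ≤ K * N * (b - a) := fun x hx => by
      rcases le_total x a with hxa | hxa
      · rw [truncSpan_eq_zero hsub hVmem x hxa, abs_zero]
        positivity
      · have := intervalIntegral.norm_integral_le_of_norm_le_const (a := a) (b := x) (f := w)
          (C := K * N) (fun y hy => by
            rw [uIoc_of_le hxa] at hy
            exact hwle y (hy.2.trans hx))
        rw [Real.norm_eq_abs, abs_of_nonneg (sub_nonneg.2 hxa)] at this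
        refine this.trans ?_
        gcongr
    have hVr : ∀ x, b ≤ x → V x = V b + (e.eval x - e.eval b) := fun x hx => by
      rw [hV]
      simp only
      rw [← intervalIntegral.integral_add_adjacent_intervals (hint a b) (hint b x)]
      congr 1
      rw [intervalIntegral.integral_congr (g := fun y => e.derivative.eval y)]
      · exact intervalIntegral.integral_eq_sub_of_hasDerivAt (f := fun y => e.eval y)
          (fun y _ => e.hasDerivAt y) (e.derivative.continuous.intervalIntegrable _ _)
      · intro y hy
        rw [uIcc_of_le hx] at hy
        exact hwr y hy.1
    -- Beyond b the primitive `V` and e have the same derivative, hence differ by a constant, which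
    -- a multiple of a step supplies. Since `V` is an integral over at most (a, b), only the term
    -- |e(b)| lacks the factor b - a.
    refine ⟨V + (e.eval b - V b) • σ, Submodule.add_mem _ hVmem (Submodule.smul_mem _ _ hσ.1),
      fun x hx => ?_, fun x hx => ?_⟩
    · simp only [Pi.add_apply, Pi.smul_apply, smul_eq_mul, hVr x hx, hσ.2.1 x hx]
      ring
    · have hs := hσ.2.2 x
      have h1 := hVle x hx
      have h2 := hVle b le_rfl
      calc |(V + (e.eval b - V b) • σ) x| ≤ |V x| + |e.eval b - V b| * |σ x| := by
            simp only [Pi.add_apply, Pi.smul_apply, smul_eq_mul]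
            exact (abs_add_le _ _).trans_eq (by rw [abs_mul])
        _ ≤ |V x| + |e.eval b - V b| * 1 := by
            gcongr
            rw [abs_of_nonneg hs.1]
            exact hs.2
        _ ≤ |V x| + (|e.eval b| + |V b|) := by
            rw [mul_one]
            gcongr
            exact abs_sub _ _
        _ ≤ |e.eval b| + 2 * K * (b - a) * N := by linarith

/-- A spline `u` with `0 ≤ u ≤ p` that rises from `0` to a nearly constant positive
polynomial `p` within `(a, b)`. -/
theorem exists_soft_transition (r : ℕ) : ∃ ε : ℝ, 0 < ε ∧ ∀ (δ : ℝ) (T : Set ℝ), 0 < δ →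
    MeshDense δ T → ∀ (a b : ℝ), -1 ≤ a → b ≤ 1 → 3 ^ (r + 1) * δ ≤ b - a →
    ∀ p : Polynomial ℝ, p.natDegree ≤ r → (b - a) * coeffNorm r p ≤ ε * p.eval a →
    ∃ u ∈ truncSpan r (T ∩ Ioo a b), (∀ x, b ≤ x → u x = p.eval x) ∧
      ∀ x ∈ Icc a b, 0 ≤ u x ∧ u x ≤ p.eval x := by
  obtain ⟨C, hC, htr⟩ := exists_transition r
  -- With this constant the oscillation r(b - a)N of p and the transition error 2C(b - a)N add up to
  -- at most p(a)/4.
  refine ⟨(4 * (r + 2 * C + 1))⁻¹, by positivity, fun δ T hδ hT a b ha hb hab p hp hsmall => ?_⟩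
  rw [pow_succ] at hab
  have h0 : 0 < (3 : ℝ) ^ r * δ := by positivity
  have hab0 : 0 < b - a := by linarith
  set c₁ := a + (b - a) / 3 with hc₁
  set c₂ := a + 2 * (b - a) / 3 with hc₂
  obtain ⟨σ₁, h₁⟩ := exists_step hδ hT r a c₁ ha (by linarith) (by linarith)
  obtain ⟨σ₃, h₃⟩ := exists_step hδ hT r c₂ b (by linarith) hb (by linarith)
  set p₀ := p.eval a with hp₀
  set N := coeffNorm r p with hN
  have hN0 : 0 ≤ N := coeffNorm_nonneg _ _
  have hsmall' : 4 * (r + 2 * C + 1) * ((b - a) * N) ≤ p₀ := by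
    rwa [← div_eq_inv_mul, le_div_iff₀' (by positivity)] at hsmall
  have hr0 : (0 : ℝ) ≤ r := Nat.cast_nonneg r
  have hbN : 0 ≤ (b - a) * N := mul_nonneg hab0.le hN0
  have hp0 : 0 ≤ p₀ := le_trans (by positivity) hsmall'
  have hNe : coeffNorm r (p - Polynomial.C p₀) ≤ 2 * N := by
    refine (coeffNorm_sub_le _ _ _).trans ?_
    rw [coeffNorm_C]
    have := abs_eval_le_coeffNorm hp (x := a) (abs_le.2 ⟨ha, by linarith⟩)
    linarith
  have hlip : ∀ x ∈ Icc a b, |p.eval x - p₀| ≤ r * ((b - a) * N) := fun x hx => by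
    have := abs_eval_sub_le hp (x := a) (y := x) ⟨ha, by linarith⟩
      ⟨by linarith [hx.1], by linarith [hx.2]⟩
    refine this.trans ?_
    rw [abs_of_nonneg (by linarith [hx.1])]
    have : (r * N) * (x - a) ≤ (r * N) * (b - a) := by
      gcongr
      exact hx.2
    linarith
  have hdeg : (p - Polynomial.C p₀).natDegree ≤ r :=
    (Polynomial.natDegree_sub_C (p := p)).le.trans hp
  obtain ⟨v, hvmem, hvr, hvb⟩ := htr δ T hδ hT c₁ c₂ (by linarith) (by linarith) (by linarith)
    (p - Polynomial.C p₀) hdeg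
  have hvle : ∀ x ≤ c₂, |v x| ≤ p₀ / 4 := fun x hx => by
    refine (hvb x hx).trans ?_
    have h1 := hlip c₂ ⟨by linarith, by linarith⟩
    have h4 := coeffNorm_nonneg r (p - Polynomial.C p₀)
    have h2 : C * (c₂ - c₁) * coeffNorm r (p - Polynomial.C p₀) ≤ C * (b - a) * (2 * N) := by
      gcongr <;> linarith
    have h3 : 0 ≤ C * ((b - a) * N) := by positivity
    simp only [Polynomial.eval_sub, Polynomial.eval_C]
    nlinarith
  have hvleft : ∀ x ≤ c₁, v x = 0 := truncSpan_eq_zero (inter_Ioo_subset_Ioi T c₁ c₂) hvmem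
  have hrange : ∀ x ∈ Icc a b, 3 / 4 * p₀ ≤ p.eval x := fun x hx => by
    have h1 := abs_le.1 (hlip x hx)
    have h3 : 0 ≤ C * ((b - a) * N) := by positivity
    nlinarith [h1.1]
  -- Here `v` passes to p - p₀ in the middle third. On the three thirds the sum is (p₀/2)σ₁, then
  -- p₀/2 + v with |v| ≤ p₀/4, then p - (p₀/2)(1 - σ₃). As p ≥ 3p₀/4 on [a, b], each lies between 0
  -- and p.
  refine ⟨(p₀ / 2) • (σ₁ + σ₃) + v, ?_, fun x hx => ?_, fun x hx => ?_⟩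
  · refine Submodule.add_mem _ (Submodule.smul_mem _ _ (Submodule.add_mem _ ?_ ?_)) ?_
    · exact truncSpan_mono (inter_Ioo_subset_inter_Ioo T le_rfl (by linarith)) h₁.1
    · exact truncSpan_mono (inter_Ioo_subset_inter_Ioo T (by linarith) le_rfl) h₃.1
    · exact truncSpan_mono (inter_Ioo_subset_inter_Ioo T (by linarith) (by linarith)) hvmem
  · simp [h₁.2.1 x (by linarith), h₃.2.1 x hx, hvr x (by linarith)]
  · have hpx := hrange x hx
    have hs₁ := h₁.2.2 x
    have hs₃ := h₃.2.2 x
    simp only [Pi.add_apply, Pi.smul_apply, smul_eq_mul]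
    rcases le_total x c₁ with hx1 | hx1
    · rw [hvleft x hx1, h₃.left x (by linarith)]
      constructor <;> nlinarith
    · rw [h₁.2.1 x hx1]
      rcases le_total x c₂ with hx2 | hx2
      · rw [h₃.left x hx2]
        have := abs_le.1 (hvle x hx2)
        constructor <;> linarith [this.1, this.2]
      · rw [hvr x hx2, Polynomial.eval_sub, Polynomial.eval_C]
        constructor <;> nlinarith

/-! ### Local correction of the q-th derivative -/

/-- `pm + v` is a nonnegative spline joining `pm` to `pp`, and it has the mass and the first moment
of `pm` on `[-1, 0]`, plus a point mass `κ` at `0`, plus `pp` on `[0, 1]`. -/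
structure IsLocalCorrection (r : ℕ) (T : Set ℝ) (pm pp : Polynomial ℝ) (κ B : ℝ) (v : ℝ → ℝ) :
    Prop where
  mem : v ∈ truncSpan r (T ∩ Ioo (-1) 1)
  right : ∀ x, 1 ≤ x → v x = (pp - pm).eval x
  nonneg : ∀ x ∈ Icc (-1 : ℝ) 1, 0 ≤ pm.eval x + v x
  bound : ∀ x ∈ Icc (-1 : ℝ) 1, |v x| ≤ B
  mass : ∫ x in (-1 : ℝ)..1, v x = κ + ∫ x in (0 : ℝ)..1, (pp - pm).eval x
  moment : ∫ x in (-1 : ℝ)..1, x * v x = ∫ x in (0 : ℝ)..1, x * (pp - pm).eval x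

theorem abs_integral_le_of_abs_le {f : ℝ → ℝ} {a b B : ℝ} (hab : a ≤ b)
    (h : ∀ x ∈ Icc a b, |f x| ≤ B) : |∫ x in a..b, f x| ≤ B * (b - a) := by
  have := intervalIntegral.norm_integral_le_of_norm_le_const (a := a) (b := b) (f := f) (C := B)
    (fun x hx => by
      rw [uIoc_of_le hab] at hx
      exact h x ⟨hx.1.le, hx.2⟩)
  rwa [Real.norm_eq_abs, abs_of_nonneg (sub_nonneg.2 hab)] at this

/-- Adding multiples of two bumps adjusts the mass and the first moment. -/
theorem exists_moment_correction {r : ℕ} {T : Set ℝ} {d : Polynomial ℝ} (hd : d.natDegree ≤ r)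
    {κ D B : ℝ} (hκ : 0 ≤ κ) (hκD : κ ≤ D) (hdD : coeffNorm r d ≤ D) {v : ℝ → ℝ}
    (hv : v ∈ truncSpan r (T ∩ Ioo (-1) 1)) (hvr : ∀ x, 1 ≤ x → v x = d.eval x)
    (hvB : ∀ x ∈ Icc (-1 : ℝ) 1, |v x| ≤ B) {a₁ b₁ a₂ b₂ : ℝ} {g₁ g₂ : ℝ → ℝ}
    (ha₁ : -1 ≤ a₁) (hb₁ : b₁ < a₂) (hb₂ : b₂ ≤ 1) (hg₁ : IsBump r T a₁ b₁ g₁)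
    (hg₂ : IsBump r T a₂ b₂ g₂) : ∃ c₁ c₂ : ℝ,
      |c₁| ≤ 4 * (D + B) / (a₂ - b₁) ∧ |c₂| ≤ 4 * (D + B) / (a₂ - b₁) ∧
      (∃ x₁ ∈ Icc a₁ b₁, ∃ x₂ ∈ Icc a₂ b₂,
        c₁ * (x₂ - x₁) = κ * x₂ - (∫ x in (-1 : ℝ)..0, (x₂ - x) * v x) +
          ∫ x in (0 : ℝ)..1, (x₂ - x) * (d.eval x - v x) ∧
        c₂ * (x₂ - x₁) = κ * (-x₁) - (∫ x in (-1 : ℝ)..0, (x - x₁) * v x) +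
          ∫ x in (0 : ℝ)..1, (x - x₁) * (d.eval x - v x)) ∧
      v + c₁ • g₁ + c₂ • g₂ ∈ truncSpan r (T ∩ Ioo (-1) 1) ∧
      (∀ x, 1 ≤ x → (v + c₁ • g₁ + c₂ • g₂) x = d.eval x) ∧
      ∫ x in (-1 : ℝ)..1, (v + c₁ • g₁ + c₂ • g₂) x = κ + ∫ x in (0 : ℝ)..1, d.eval x ∧
      ∫ x in (-1 : ℝ)..1, x * (v + c₁ • g₁ + c₂ • g₂) x = ∫ x in (0 : ℝ)..1, x * d.eval x := by
  have hB0 : 0 ≤ B := (abs_nonneg _).trans (hvB 0 (by norm_num))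
  have hint := truncSpan_intervalIntegrable hv
  have hint₁ := truncSpan_intervalIntegrable hg₁.mem
  have hint₂ := truncSpan_intervalIntegrable hg₂.mem
  have hdint : ∀ u w, IntervalIntegrable (fun x => d.eval x) volume u w := fun u w =>
    d.continuous.intervalIntegrable u w
  have hmul : ∀ {f : ℝ → ℝ}, (∀ u w, IntervalIntegrable f volume u w) →
      ∀ u w, IntervalIntegrable (fun x => x * f x) volume u w := fun hf u w =>
    (hf u w).continuousOn_mul continuousOn_id
  set x₁ := ∫ x in (-1 : ℝ)..1, x * g₁ x with hx₁
  set x₂ := ∫ x in (-1 : ℝ)..1, x * g₂ x with hx₂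
  have hm₁ : x₁ ∈ Icc a₁ b₁ := hg₁.moment
  have hm₂ : x₂ ∈ Icc a₂ b₂ := hg₂.moment
  have hgap : a₂ - b₁ ≤ x₂ - x₁ := by linarith [hm₁.2, hm₂.1]
  have hgap0 : 0 < a₂ - b₁ := by linarith
  have hpos : 0 < x₂ - x₁ := by linarith
  -- `A` and `M` are the missing mass and first moment. The coefficients solve c₁ + c₂ = A, c₁x₁ +
  -- c₂x₂ = M, where x₁ and x₂ are the centres of mass of the bumps; the determinant x₂ - x₁ is at
  -- least a₂ - b₁.
  set A := κ + (∫ x in (0 : ℝ)..1, d.eval x) - ∫ x in (-1 : ℝ)..1, v x with hA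
  set M := (∫ x in (0 : ℝ)..1, x * d.eval x) - ∫ x in (-1 : ℝ)..1, x * v x with hM
  have hone : ∀ x ∈ Icc (0 : ℝ) 1, |d.eval x| ≤ D := fun x hx =>
    (abs_eval_le_coeffNorm hd (abs_le.2 ⟨by linarith [hx.1], hx.2⟩)).trans hdD
  have hxmul : ∀ {f : ℝ → ℝ} {E x : ℝ}, |x| ≤ 1 → |f x| ≤ E → |x * f x| ≤ E := by
    intro f E x hx hf
    rw [abs_mul]
    exact (mul_le_of_le_one_left (abs_nonneg _) hx).trans hf
  have hAle : |A| ≤ 2 * (D + B) := by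
    have h1 := abs_le.1 (abs_integral_le_of_abs_le zero_le_one hone)
    have h2 := abs_le.1 (abs_integral_le_of_abs_le (by norm_num) hvB)
    exact abs_le.2 ⟨by linarith [h1.1, h2.2], by linarith [h1.2, h2.1]⟩
  have hMle : |M| ≤ 2 * (D + B) := by
    have h1 := abs_le.1 (abs_integral_le_of_abs_le (f := fun x => x * d.eval x) zero_le_one
      fun x hx => hxmul (f := fun x => d.eval x)
        (abs_le.2 ⟨by linarith [hx.1], hx.2⟩) (hone x hx))
    have h2 := abs_le.1 (abs_integral_le_of_abs_le (f := fun x => x * v x) (by norm_num)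
      fun x hx => hxmul (f := v) (abs_le.2 hx) (hvB x hx))
    exact abs_le.2 ⟨by linarith [h1.1, h2.2], by linarith [h1.2, h2.1]⟩
  have hcoef : ∀ y : ℝ, |y| ≤ 1 → |A * y - M| ≤ 4 * (D + B) := fun y hy => by
    have h1 : |A * y| ≤ 2 * (D + B) := by
      rw [abs_mul]
      exact (mul_le_of_le_one_right (abs_nonneg _) hy).trans hAle
    exact (abs_sub _ _).trans (by linarith)
  have hx₁1 : |x₁| ≤ 1 := abs_le.2 ⟨by linarith [hm₁.1], by linarith [hm₁.2, hm₂.1, hm₂.2]⟩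
  have hx₂1 : |x₂| ≤ 1 := abs_le.2 ⟨by linarith [hm₁.1, hm₁.2, hm₂.1], by linarith [hm₂.2]⟩
  have hD0 : 0 ≤ D := hκ.trans hκD
  have hdiv : ∀ E : ℝ, |E| ≤ 4 * (D + B) → |E / (x₂ - x₁)| ≤ 4 * (D + B) / (a₂ - b₁) := by
    intro E hE
    rw [abs_div, abs_of_pos hpos]
    gcongr
  have hc₁ : (A * x₂ - M) / (x₂ - x₁) * (x₂ - x₁) = A * x₂ - M := div_mul_cancel₀ _ hpos.ne'
  have hc₂ : (M - A * x₁) / (x₂ - x₁) * (x₂ - x₁) = M - A * x₁ := div_mul_cancel₀ _ hpos.ne'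
  -- The defect measure tested against a linear weight α + βx: the point mass κ at 0, the density -v
  -- on the left and d - v on the right. The weights x₂ - x and x - x₁ give c₁(x₂ - x₁) and c₂(x₂ -
  -- x₁), a form from which signs can be read off.
  have hlin : ∀ α β : ℝ, α * A + β * M = κ * α -
      (∫ x in (-1 : ℝ)..0, (α + β * x) * v x) +
        ∫ x in (0 : ℝ)..1, (α + β * x) * (d.eval x - v x) := by
    intro α β
    have e1 : ∫ x in (-1 : ℝ)..0, (α + β * x) * v x =
        α * (∫ x in (-1 : ℝ)..0, v x) + β * ∫ x in (-1 : ℝ)..0, x * v x := by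
      rw [← intervalIntegral.integral_const_mul, ← intervalIntegral.integral_const_mul,
        ← intervalIntegral.integral_add ((hint _ _).const_mul α) ((hmul hint _ _).const_mul β)]
      exact intervalIntegral.integral_congr fun x _ => by ring
    have e2 : ∫ x in (0 : ℝ)..1, (α + β * x) * (d.eval x - v x) =
        (α * (∫ x in (0 : ℝ)..1, d.eval x) + β * ∫ x in (0 : ℝ)..1, x * d.eval x) -
        (α * (∫ x in (0 : ℝ)..1, v x) + β * ∫ x in (0 : ℝ)..1, x * v x) := by
      simp only [← intervalIntegral.integral_const_mul]
      rw [← intervalIntegral.integral_add ((hint _ _).const_mul α) ((hmul hint _ _).const_mul β),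
        ← intervalIntegral.integral_add ((hdint _ _).const_mul α) ((hmul hdint _ _).const_mul β),
        ← intervalIntegral.integral_sub
          (((hdint _ _).const_mul α).add ((hmul hdint _ _).const_mul β))
          (((hint _ _).const_mul α).add ((hmul hint _ _).const_mul β))]
      exact intervalIntegral.integral_congr fun x _ => by ring
    rw [e1, e2, hA, hM,
      ← intervalIntegral.integral_add_adjacent_intervals (hint (-1) 0) (hint 0 1),
      ← intervalIntegral.integral_add_adjacent_intervals (hmul hint (-1) 0) (hmul hint 0 1)]
    ring
  have happ : ∀ (c₁ c₂ x : ℝ), (v + c₁ • g₁ + c₂ • g₂) x = v x + c₁ * g₁ x + c₂ * g₂ x :=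
    fun _ _ _ => rfl
  refine ⟨(A * x₂ - M) / (x₂ - x₁), (M - A * x₁) / (x₂ - x₁), hdiv _ (hcoef _ hx₂1),
    hdiv _ (by rw [abs_sub_comm]; exact hcoef _ hx₁1),
    ⟨x₁, hm₁, x₂, hm₂, ?_, ?_⟩, ?_, fun x hx => ?_, ?_, ?_⟩
  · rw [hc₁]
    have h := hlin x₂ (-1)
    calc A * x₂ - M = x₂ * A + -1 * M := by ring
      _ = _ := h
      _ = _ := by simp only [neg_one_mul, ← sub_eq_add_neg]
  · rw [hc₂]
    have h := hlin (-x₁) 1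
    calc M - A * x₁ = -x₁ * A + 1 * M := by ring
      _ = _ := h
      _ = _ := by simp only [one_mul, neg_add_eq_sub]
  · refine Submodule.add_mem _ (Submodule.add_mem _ hv (Submodule.smul_mem _ _ ?_))
      (Submodule.smul_mem _ _ ?_)
    · exact truncSpan_mono (inter_Ioo_subset_inter_Ioo T ha₁ (by linarith [hm₂.1, hm₂.2])) hg₁.mem
    · exact truncSpan_mono (inter_Ioo_subset_inter_Ioo T (by linarith [hm₁.1, hm₁.2]) hb₂) hg₂.mem
  · rw [happ, hvr x hx, hg₁.right x (by linarith [hm₂.1, hm₂.2]), hg₂.right x (by linarith)]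
    ring
  · simp only [happ]
    rw [intervalIntegral.integral_add ((hint _ _).add ((hint₁ _ _).const_mul _))
      ((hint₂ _ _).const_mul _), intervalIntegral.integral_add (hint _ _) ((hint₁ _ _).const_mul _),
      intervalIntegral.integral_const_mul, intervalIntegral.integral_const_mul, hg₁.mass, hg₂.mass]
    have : (A * x₂ - M) / (x₂ - x₁) + (M - A * x₁) / (x₂ - x₁) = A := by
      rw [← add_div, div_eq_iff hpos.ne']
      ring
    linarith
  · have e : ∀ c₁ c₂ x : ℝ, x * (v + c₁ • g₁ + c₂ • g₂) x =
        x * v x + c₁ * (x * g₁ x) + c₂ * (x * g₂ x) := fun _ _ _ => by rw [happ]; ring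
    simp only [e]
    rw [intervalIntegral.integral_add ((hmul hint _ _).add ((hmul hint₁ _ _).const_mul _))
      ((hmul hint₂ _ _).const_mul _),
      intervalIntegral.integral_add (hmul hint _ _) ((hmul hint₁ _ _).const_mul _),
      intervalIntegral.integral_const_mul, intervalIntegral.integral_const_mul, ← hx₁, ← hx₂]
    have : (A * x₂ - M) / (x₂ - x₁) * x₁ + (M - A * x₁) / (x₂ - x₁) * x₂ = M := by
      rw [div_mul_eq_mul_div, div_mul_eq_mul_div, ← add_div, div_eq_iff hpos.ne']
      ring
    linarith

/-- A spline `u` rising from `0` to `p` within `(a, b)` with `0 ≤ u ≤ p` there. -/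
structure IsSoftTransition (r : ℕ) (T : Set ℝ) (a b : ℝ) (p : Polynomial ℝ) (u : ℝ → ℝ) :
    Prop where
  mem : u ∈ truncSpan r (T ∩ Ioo a b)
  right : ∀ x, b ≤ x → u x = p.eval x
  between : ∀ x ∈ Icc a b, 0 ≤ u x ∧ u x ≤ p.eval x

namespace IsSoftTransition

variable {r : ℕ} {T : Set ℝ} {a b : ℝ} {p : Polynomial ℝ} {u : ℝ → ℝ}

theorem left (h : IsSoftTransition r T a b p u) : ∀ x ≤ a, u x = 0 :=
  truncSpan_eq_zero (inter_Ioo_subset_Ioi T a b) h.mem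

theorem abs_le_coeffNorm (h : IsSoftTransition r T a b p u) (hp : p.natDegree ≤ r) {x : ℝ}
    (hx : x ∈ Icc (-1 : ℝ) 1) : |u x| ≤ coeffNorm r p := by
  have hN := abs_eval_le_coeffNorm hp (abs_le.2 hx)
  rcases le_total x a with hxa | hxa
  · rw [h.left x hxa, abs_zero]
    exact coeffNorm_nonneg _ _
  · rcases le_total x b with hxb | hxb
    · rw [abs_of_nonneg (h.between x ⟨hxa, hxb⟩).1]
      exact (h.between x ⟨hxa, hxb⟩).2.trans ((le_abs_self _).trans hN)
    · rw [h.right x hxb]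
      exact hN

theorem nonneg (h : IsSoftTransition r T a b p u) {x : ℝ} (hp : 0 ≤ p.eval x) : 0 ≤ u x := by
  rcases le_total x a with hxa | hxa
  · exact (h.left x hxa).ge
  · rcases le_total x b with hxb | hxb
    · exact (h.between x ⟨hxa, hxb⟩).1
    · rwa [h.right x hxb]

theorem le_eval (h : IsSoftTransition r T a b p u) {x : ℝ} (hp : 0 ≤ p.eval x) :
    u x ≤ p.eval x := by
  rcases le_total x a with hxa | hxa
  · rwa [h.left x hxa]
  · rcases le_total x b with hxb | hxb
    · exact (h.between x ⟨hxa, hxb⟩).2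
    · exact (h.right x hxb).le

end IsSoftTransition

/-- The case in which the polynomials are small compared with the jump: both are cut off near the
knot, and two bumps restore the moments. -/
theorem exists_local_correction_of_cutoff {r : ℕ} {T : Set ℝ} {pm pp : Polynomial ℝ}
    (hpm : pm.natDegree ≤ r) (hpp : pp.natDegree ≤ r)
    (hm0 : ∀ x ∈ Icc (-1 : ℝ) 0, 0 ≤ pm.eval x) (hp0 : ∀ x ∈ Icc (0 : ℝ) 1, 0 ≤ pp.eval x)
    {κ D : ℝ} (hκ : 0 ≤ κ) (hκD : κ ≤ D) (hdD : coeffNorm r (pp - pm) ≤ D)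
    {am bm ap bp : ℝ} {um up g₁ g₂ : ℝ → ℝ} (ham : -(3 / 4) ≤ am) (habm : am < bm) (hbm : bm ≤ 0)
    (hap : 0 ≤ ap) (hbp : bp ≤ 3 / 4)
    (hum : IsSoftTransition r T am bm pm um) (hup : IsSoftTransition r T ap bp pp up)
    (hg₁ : IsBump r T (-1) (-(3 / 4)) g₁) (hg₂ : IsBump r T (3 / 4) 1 g₂) :
    ∃ v, IsLocalCorrection r T pm pp κ
      (100 * (D + (coeffNorm r pm + coeffNorm r pp))) v := by
  set B := coeffNorm r pm + coeffNorm r pp with hB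
  have hB0 : 0 ≤ B := add_nonneg (coeffNorm_nonneg _ _) (coeffNorm_nonneg _ _)
  have hD0 : 0 ≤ D := hκ.trans hκD
  have happ : ∀ x, (up - um) x = up x - um x := fun _ => rfl
  have hmem : up - um ∈ truncSpan r (T ∩ Ioo (-1) 1) :=
    Submodule.sub_mem _
      (truncSpan_mono (inter_Ioo_subset_inter_Ioo T (by linarith) (by linarith)) hup.mem)
      (truncSpan_mono (inter_Ioo_subset_inter_Ioo T (by linarith) (by linarith)) hum.mem)
  have hright : ∀ x, 1 ≤ x → (up - um) x = (pp - pm).eval x := fun x hx => by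
    rw [happ, hup.right x (by linarith), hum.right x (by linarith), Polynomial.eval_sub]
  have hbound : ∀ x ∈ Icc (-1 : ℝ) 1, |(up - um) x| ≤ B := fun x hx => by
    have h1 := hum.abs_le_coeffNorm hpm hx
    have h2 := hup.abs_le_coeffNorm hpp hx
    rw [happ]
    exact (abs_sub _ _).trans (by linarith)
  obtain ⟨c₁, c₂, hc₁, hc₂, ⟨x₁, hx₁, x₂, hx₂, he₁, he₂⟩, h1, h2, h3, h4⟩ :=
    exists_moment_correction ((Polynomial.natDegree_sub_le pp pm).trans (max_le hpp hpm)) hκ hκD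
      hdD hmem hright hbound le_rfl (by norm_num) le_rfl hg₁ hg₂
  have hpos : 0 < x₂ - x₁ := by linarith [hx₁.2, hx₂.1]
  -- After the cutoff the defect consists of κ at 0, `um` on the left and pp - `up` on the right. It
  -- is nonnegative and vanishes outside [-3/4, 3/4], where both linear weights are nonnegative
  -- since the bumps sit farther out. Hence both coefficients are nonnegative.
  have hneg : ∀ w : ℝ → ℝ, (∀ x ∈ Icc (-(3 / 4) : ℝ) 0, 0 ≤ w x) →
      (∫ x in (-1 : ℝ)..0, w x * (up - um) x) ≤ 0 := by
    intro w hw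
    refine neg_nonneg.1 ?_
    rw [← intervalIntegral.integral_neg]
    refine intervalIntegral.integral_nonneg (by norm_num) fun x hx => neg_nonneg.2 ?_
    rw [happ, hup.left x (by linarith [hx.2]), zero_sub, mul_neg, neg_nonpos]
    rcases le_total x (-(3 / 4)) with h | h
    · rw [hum.left x (by linarith), mul_zero]
    · exact mul_nonneg (hw x ⟨h, hx.2⟩) (hum.nonneg (hm0 x hx))
  have hposi : ∀ w : ℝ → ℝ, (∀ x ∈ Icc (0 : ℝ) (3 / 4), 0 ≤ w x) →
      0 ≤ ∫ x in (0 : ℝ)..1, w x * ((pp - pm).eval x - (up - um) x) := by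
    intro w hw
    refine intervalIntegral.integral_nonneg (by norm_num) fun x hx => ?_
    rw [happ, hum.right x (by linarith [hx.1]), Polynomial.eval_sub]
    have hle := hup.le_eval (hp0 x hx)
    rcases le_total x (3 / 4) with h | h
    · exact mul_nonneg (hw x ⟨hx.1, h⟩) (by linarith)
    · rw [hup.right x (by linarith)]
      simp
  have hc₁0 : 0 ≤ c₁ := by
    refine nonneg_of_mul_nonneg_left ?_ hpos
    rw [he₁]
    have := hneg (fun x => x₂ - x) fun x hx => by linarith [hx.2, hx₂.1]
    have := hposi (fun x => x₂ - x) fun x hx => by linarith [hx.2, hx₂.1]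
    have : 0 ≤ κ * x₂ := mul_nonneg hκ (by linarith [hx₂.1])
    linarith
  have hc₂0 : 0 ≤ c₂ := by
    refine nonneg_of_mul_nonneg_left ?_ hpos
    rw [he₂]
    have := hneg (fun x => x - x₁) fun x hx => by linarith [hx.1, hx₁.2]
    have := hposi (fun x => x - x₁) fun x hx => by linarith [hx.1, hx₁.2]
    have : 0 ≤ κ * (-x₁) := mul_nonneg hκ (by linarith [hx₁.2])
    linarith
  refine ⟨_, h1, h2, fun x hx => ?_, fun x hx => ?_, h3, h4⟩
  · have k1 : 0 ≤ c₁ * g₁ x := mul_nonneg hc₁0 (hg₁.nonneg x)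
    have k2 : 0 ≤ c₂ * g₂ x := mul_nonneg hc₂0 (hg₂.nonneg x)
    have k3 : 0 ≤ pm.eval x + (up - um) x := by
      rw [happ]
      rcases le_total x 0 with h | h
      · rw [hup.left x (by linarith)]
        have := hum.le_eval (hm0 x ⟨hx.1, h⟩)
        linarith
      · rw [hum.right x (by linarith)]
        have := hup.nonneg (hp0 x ⟨h, hx.2⟩)
        linarith
    simp only [Pi.add_apply, Pi.smul_apply, smul_eq_mul]
    linarith
  · have k0 := hbound x hx
    have k1 : |c₁ * g₁ x| ≤ 4 * (D + B) / (3 / 4 - -(3 / 4)) * (3 / (-(3 / 4) - -1)) := by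
      rw [abs_mul, abs_of_nonneg (hg₁.nonneg x)]
      exact mul_le_mul hc₁ (hg₁.le x) (hg₁.nonneg x) ((abs_nonneg _).trans hc₁)
    have k2 : |c₂ * g₂ x| ≤ 4 * (D + B) / (3 / 4 - -(3 / 4)) * (3 / (1 - 3 / 4)) := by
      rw [abs_mul, abs_of_nonneg (hg₂.nonneg x)]
      exact mul_le_mul hc₂ (hg₂.le x) (hg₂.nonneg x) ((abs_nonneg _).trans hc₂)
    simp only [Pi.add_apply, Pi.smul_apply, smul_eq_mul]
    calc |(up - um) x + c₁ * g₁ x + c₂ * g₂ x|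
        ≤ |(up - um) x| + |c₁ * g₁ x| + |c₂ * g₂ x| := abs_add_three _ _ _
      _ ≤ 100 * (D + B) := by
        have e : 4 * (D + B) / (3 / 4 - -(3 / 4)) * (3 / (-(3 / 4) - -1)) = 32 * (D + B) := by ring
        have e' : 4 * (D + B) / (3 / 4 - -(3 / 4)) * (3 / (1 - 3 / 4)) = 32 * (D + B) := by ring
        rw [e] at k1
        rw [e'] at k2
        linarith

/-- The case in which the polynomials are large compared with the jump: the spline is raised near
the knot, and two bumps in a region where `pm` is large restore the moments. -/
theorem exists_local_correction_of_large {r : ℕ} {T : Set ℝ} {pm pp : Polynomial ℝ}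
    (hpm : pm.natDegree ≤ r) (hpp : pp.natDegree ≤ r)
    (hm0 : ∀ x ∈ Icc (-1 : ℝ) 0, 0 ≤ pm.eval x) (hp0 : ∀ x ∈ Icc (0 : ℝ) 1, 0 ≤ pp.eval x)
    {κ D : ℝ} (hκ : 0 ≤ κ) (hκD : κ ≤ D) (hdD : coeffNorm r (pp - pm) ≤ D)
    {a ρ as bs ap bp : ℝ} {σ u g₁ g₂ : ℝ → ℝ} (hρ : 0 < ρ) (ha : -1 ≤ a) (haρ : a + ρ ≤ 0)
    (has : -1 ≤ as) (hbs : bs ≤ 0) (hap : 0 ≤ ap) (hbp : bp ≤ 1)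
    (hσ : IsStep r T as bs σ)
    (hu : IsSoftTransition r T ap bp (Polynomial.C (2 * D) - (pp - pm)) u)
    (hg₁ : IsBump r T a (a + ρ / 3) g₁) (hg₂ : IsBump r T (a + 2 * ρ / 3) (a + ρ) g₂)
    (hlarge : ∀ x ∈ Icc a (a + ρ), 1296 / ρ ^ 2 * D ≤ pm.eval x) :
    ∃ v, IsLocalCorrection r T pm pp κ ((5 + 1296 / ρ ^ 2) * D) v := by
  have hD0 : 0 ≤ D := hκ.trans hκD
  have hddeg : (pp - pm).natDegree ≤ r := (Polynomial.natDegree_sub_le pp pm).trans (max_le hpp hpm)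
  have hfdeg : (Polynomial.C (2 * D) - (pp - pm)).natDegree ≤ r :=
    (Polynomial.natDegree_sub_le _ _).trans (max_le ((Polynomial.natDegree_C _).trans_le (Nat.zero_le _)) hddeg)
  have hfN : coeffNorm r (Polynomial.C (2 * D) - (pp - pm)) ≤ 3 * D := by
    refine (coeffNorm_sub_le _ _ _).trans ?_
    rw [coeffNorm_C, abs_of_nonneg (by positivity)]
    linarith
  have hdx : ∀ x ∈ Icc (-1 : ℝ) 1, |(pp - pm).eval x| ≤ D := fun x hx =>
    (abs_eval_le_coeffNorm hddeg (abs_le.2 hx)).trans hdD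
  have hfe : ∀ x, (Polynomial.C (2 * D) - (pp - pm)).eval x =
      2 * D - (pp.eval x - pm.eval x) := fun x => by simp
  have hf0 : ∀ x ∈ Icc (-1 : ℝ) 1, 0 ≤ (Polynomial.C (2 * D) - (pp - pm)).eval x := fun x hx => by
    have := abs_le.1 (hdx x hx)
    rw [Polynomial.eval_sub] at this
    rw [hfe]
    linarith [this.2]
  -- Left of the knot the term 2Dσ only raises pm. Right of it σ = 1, and u ≤ 2D - d gives v₀ ≥ d,
  -- so that pm + v₀ ≥ pp ≥ 0.
  set v₀ : ℝ → ℝ := (2 * D) • σ - u with hv₀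
  have happ : ∀ x, v₀ x = 2 * D * σ x - u x := fun _ => rfl
  have hmem : v₀ ∈ truncSpan r (T ∩ Ioo (-1) 1) :=
    Submodule.sub_mem _ (Submodule.smul_mem _ _
      (truncSpan_mono (inter_Ioo_subset_inter_Ioo T has (by linarith)) hσ.1))
      (truncSpan_mono (inter_Ioo_subset_inter_Ioo T (by linarith) hbp) hu.mem)
  have hright : ∀ x, 1 ≤ x → v₀ x = (pp - pm).eval x := fun x hx => by
    rw [happ, hσ.2.1 x (by linarith), hu.right x (by linarith), hfe, Polynomial.eval_sub]
    ring
  have hbound : ∀ x ∈ Icc (-1 : ℝ) 1, |v₀ x| ≤ 5 * D := fun x hx => by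
    have h1 := abs_le.1 ((hu.abs_le_coeffNorm hfdeg hx).trans hfN)
    have h2 := hσ.2.2 x
    have h3 : 0 ≤ 2 * D * σ x := by
      have := h2.1
      positivity
    have h4 : 2 * D * σ x ≤ 2 * D * 1 := by
      gcongr
      exact h2.2
    rw [happ]
    exact abs_le.2 ⟨by linarith [h1.2], by linarith [h1.1]⟩
  have hbase : ∀ x ∈ Icc (-1 : ℝ) 1, 0 ≤ pm.eval x + v₀ x ∧
      (x ≤ 0 → pm.eval x ≤ pm.eval x + v₀ x) := fun x hx => by
    rw [happ]
    rcases le_total x 0 with h | h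
    · have h1 : 0 ≤ 2 * D * σ x := mul_nonneg (by positivity) (hσ.2.2 x).1
      rw [hu.left x (by linarith)]
      have := hm0 x ⟨hx.1, h⟩
      exact ⟨by linarith, fun _ => by linarith⟩
    · have h1 := hu.le_eval (hf0 x hx)
      rw [hfe] at h1
      rw [hσ.2.1 x (by linarith)]
      have := hp0 x ⟨h, hx.2⟩
      refine ⟨by linarith, fun h0 => ?_⟩
      rw [hu.left x (by linarith)]
      linarith
  obtain ⟨c₁, c₂, hc₁, hc₂, -, h1, h2, h3, h4⟩ :=
    exists_moment_correction hddeg hκ hκD hdD hmem hright hbound ha (by linarith)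
      (by linarith : a + ρ ≤ 1) hg₁ hg₂
  have hK : 4 * (D + 5 * D) / (a + 2 * ρ / 3 - (a + ρ / 3)) = 72 * D / ρ := by
    rw [show a + 2 * ρ / 3 - (a + ρ / 3) = ρ / 3 by ring]
    field_simp
    ring
  rw [hK] at hc₁ hc₂
  -- Coefficients are at most 72D/ρ and heights at most 9/ρ, so each bump contributes at most
  -- 648D/ρ². The coefficients may be negative, which is why pm is required to exceed the total.
  have hbump : ∀ x, |c₁ * g₁ x| + |c₂ * g₂ x| ≤ 1296 / ρ ^ 2 * D := fun x => by
    have hg₁x : g₁ x ≤ 9 / ρ := (hg₁.le x).trans_eq (by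
      rw [show a + ρ / 3 - a = ρ / 3 by ring]
      field_simp
      norm_num)
    have hg₂x : g₂ x ≤ 9 / ρ := (hg₂.le x).trans_eq (by
      rw [show a + ρ - (a + 2 * ρ / 3) = ρ / 3 by ring]
      field_simp
      norm_num)
    have k1 : |c₁ * g₁ x| ≤ 72 * D / ρ * (9 / ρ) := by
      rw [abs_mul, abs_of_nonneg (hg₁.nonneg x)]
      exact mul_le_mul hc₁ hg₁x (hg₁.nonneg x) (by positivity)
    have k2 : |c₂ * g₂ x| ≤ 72 * D / ρ * (9 / ρ) := by
      rw [abs_mul, abs_of_nonneg (hg₂.nonneg x)]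
      exact mul_le_mul hc₂ hg₂x (hg₂.nonneg x) (by positivity)
    calc _ ≤ 72 * D / ρ * (9 / ρ) + 72 * D / ρ * (9 / ρ) := add_le_add k1 k2
      _ = _ := by
        field_simp
        ring
  refine ⟨_, h1, h2, fun x hx => ?_, fun x hx => ?_, h3, h4⟩
  · simp only [Pi.add_apply, Pi.smul_apply, smul_eq_mul]
    obtain ⟨hb1, hb2⟩ := hbase x hx
    by_cases hxI : x ∈ Icc a (a + ρ)
    · have k := hbump x
      have k1 := neg_abs_le (c₁ * g₁ x)
      have k2 := neg_abs_le (c₂ * g₂ x)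
      have k3 := hlarge x hxI
      have k4 := hb2 (by linarith [hxI.2])
      linarith
    · have hz : g₁ x = 0 ∧ g₂ x = 0 := by
        rcases lt_or_ge x a with h | h
        · exact ⟨hg₁.left x h.le, hg₂.left x (by linarith)⟩
        · have h' : a + ρ < x := by
            by_contra hcon
            exact hxI ⟨h, not_lt.1 hcon⟩
          exact ⟨hg₁.right x (by linarith), hg₂.right x h'.le⟩
      rw [hz.1, hz.2]
      linarith
  · simp only [Pi.add_apply, Pi.smul_apply, smul_eq_mul]
    calc |v₀ x + c₁ * g₁ x + c₂ * g₂ x|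
        ≤ |v₀ x| + |c₁ * g₁ x| + |c₂ * g₂ x| := abs_add_three _ _ _
      _ ≤ (5 + 1296 / ρ ^ 2) * D := by linarith [hbound x hx, hbump x]

/-- The two regimes are separated by comparing the coefficient norm of `pm` with `K * D`. If it is
larger, `pm` stays large on a short interval to the right of a point where it is comparable with its
norm. If it is smaller, the norm of `pp` is also bounded by (K + 1)D, so bounds in terms of the
polynomials themselves are affordable. -/
theorem exists_local_correction (r : ℕ) : ∃ δ : ℝ, 0 < δ ∧ ∃ C : ℝ, 0 ≤ C ∧
    ∀ T : Set ℝ, MeshDense δ T → ∀ pm pp : Polynomial ℝ, pm.natDegree ≤ r → pp.natDegree ≤ r →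
    (∀ x ∈ Icc (-1 : ℝ) 0, 0 ≤ pm.eval x) → (∀ x ∈ Icc (0 : ℝ) 1, 0 ≤ pp.eval x) →
    ∀ κ D : ℝ, 0 ≤ κ → κ ≤ D → coeffNorm r (pp - pm) ≤ D →
    ∃ v, IsLocalCorrection r T pm pp κ (C * D) v := by
  obtain ⟨ε, hε, hsoft⟩ := exists_soft_transition r
  obtain ⟨c₁, hc₁, hlow₁⟩ := exists_coeffNorm_le_abs_eval r
    (show (-(3 / 4) : ℝ) < -(5 / 8) by norm_num)
  obtain ⟨c₂, hc₂, hlow₂⟩ := exists_coeffNorm_le_abs_eval r (show (1 / 2 : ℝ) < 5 / 8 by norm_num)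
  -- ρ is the width of a transition. The bound 1/8 keeps the intervals within their sides of the
  -- knot; ρ ≤ εc₁, εc₂ permit cutting off pm and pp where they are comparable with their norms; ρ ≤
  -- ε/3 permits the transition to 2D - d, which has norm at most 3D and value at least D; the last
  -- bound keeps pm above half of its initial lower bound.
  obtain ⟨ρ, hρ, hρ8, hρ₁, hρ₂, hρ3, hρr⟩ : ∃ ρ : ℝ, 0 < ρ ∧ ρ ≤ 1 / 8 ∧ ρ ≤ ε * c₁ ∧
      ρ ≤ ε * c₂ ∧ ρ ≤ ε / 3 ∧ ρ ≤ c₁ / (2 * (r + 1)) := by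
    refine ⟨min (1 / 8) (min (ε * c₁) (min (ε * c₂) (min (ε / 3) (c₁ / (2 * (r + 1)))))), ?_,
      ?_, ?_, ?_, ?_, ?_⟩
    · have : 0 < c₁ / (2 * ((r : ℝ) + 1)) := by positivity
      simp only [lt_min_iff]
      exact ⟨by norm_num, by positivity, by positivity, by positivity, this⟩
    all_goals simp
  -- The narrowest pieces are bumps of width ρ/3, which require 3^(r+1) δ ≤ ρ/3.
  set δ : ℝ := ρ / 3 ^ (r + 2) with hδ
  have hδ0 : 0 < δ := by positivity
  have hδ2 : 3 ^ (r + 2) * δ = ρ := by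
    rw [hδ]
    field_simp
  have hδ1 : 3 ^ (r + 1) * δ = ρ / 3 := by
    rw [← hδ2, pow_succ 3 (r + 1)]
    ring
  have hδr : 3 ^ r * δ = ρ / 9 := by
    have := hδ1
    rw [pow_succ] at this
    linarith
  set K := 2 / c₁ * (1296 / ρ ^ 2) with hK
  have hK0 : 0 < K := by positivity
  refine ⟨δ, hδ0, 5 + 1296 / ρ ^ 2 + 100 * (2 * K + 2), by positivity, ?_⟩
  intro T hT pm pp hpm hpp hm0 hp0 κ D hκ hκD hdD
  have hD0 : 0 ≤ D := hκ.trans hκD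
  obtain ⟨xm, hxm, hxmN⟩ := hlow₁ pm hpm
  rw [abs_of_nonneg (hm0 xm ⟨by linarith [hxm.1], by linarith [hxm.2]⟩)] at hxmN
  have hcut : ∀ {c x : ℝ} {p : Polynomial ℝ}, ρ ≤ ε * c → c * coeffNorm r p ≤ p.eval x →
      (x + ρ - x) * coeffNorm r p ≤ ε * p.eval x := by
    intro c x p h1 h2
    calc (x + ρ - x) * coeffNorm r p = ρ * coeffNorm r p := by ring
      _ ≤ ε * c * coeffNorm r p := mul_le_mul_of_nonneg_right h1 (coeffNorm_nonneg _ _)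
      _ ≤ ε * p.eval x := by
        rw [mul_assoc]
        gcongr
  have hmono : ∀ {v : ℝ → ℝ} {B : ℝ},
      B ≤ (5 + 1296 / ρ ^ 2 + 100 * (2 * K + 2)) * D → IsLocalCorrection r T pm pp κ B v →
      IsLocalCorrection r T pm pp κ ((5 + 1296 / ρ ^ 2 + 100 * (2 * K + 2)) * D) v :=
    fun hB h => { h with bound := fun x hx => (h.bound x hx).trans hB }
  have hN0 := coeffNorm_nonneg r pm
  rcases le_total (K * D) (coeffNorm r pm) with hcase | hcase
  · obtain ⟨σ, hσ⟩ := exists_step hδ0 hT r (-(1 / 4)) 0 (by norm_num) (by norm_num) (by linarith)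
    obtain ⟨g₁, hg₁⟩ := exists_bump hδ0 hT r (a := xm) (b := xm + ρ / 3) (by linarith [hxm.1])
      (by linarith [hxm.2]) (by linarith)
    obtain ⟨g₂, hg₂⟩ := exists_bump hδ0 hT r (a := xm + 2 * ρ / 3) (b := xm + ρ)
      (by linarith [hxm.1]) (by linarith [hxm.2]) (by linarith)
    have hddeg : (pp - pm).natDegree ≤ r :=
      (Polynomial.natDegree_sub_le pp pm).trans (max_le hpp hpm)
    obtain ⟨u, hu1, hu2, hu3⟩ := hsoft δ T hδ0 hT (1 / 4) (1 / 4 + ρ) (by norm_num) (by linarith)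
      (by linarith) (Polynomial.C (2 * D) - (pp - pm))
      ((Polynomial.natDegree_sub_le _ _).trans (max_le ((Polynomial.natDegree_C _).trans_le (Nat.zero_le _)) hddeg)) (by
        have h1 : coeffNorm r (Polynomial.C (2 * D) - (pp - pm)) ≤ 3 * D := by
          refine (coeffNorm_sub_le _ _ _).trans ?_
          rw [coeffNorm_C, abs_of_nonneg (by positivity)]
          linarith
        have h2 := abs_le.1 ((abs_eval_le_coeffNorm hddeg (x := 1 / 4)
          (by norm_num [abs_of_pos])).trans hdD)
        have h3 : D ≤ (Polynomial.C (2 * D) - (pp - pm)).eval (1 / 4) := by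
          rw [Polynomial.eval_sub, Polynomial.eval_C]
          linarith [h2.2]
        calc _ = ρ * coeffNorm r (Polynomial.C (2 * D) - (pp - pm)) := by ring
          _ ≤ ε / 3 * (3 * D) := mul_le_mul hρ3 h1 (coeffNorm_nonneg _ _) (by positivity)
          _ = ε * D := by ring
          _ ≤ _ := by gcongr)
    obtain ⟨v, hv⟩ := exists_local_correction_of_large hpm hpp hm0 hp0 hκ hκD hdD hρ
      (by linarith [hxm.1]) (by linarith [hxm.2]) (by norm_num) le_rfl (by norm_num)
      (by linarith) hσ ⟨hu1, hu2, hu3⟩ hg₁ hg₂ (fun x hx => by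
        have h1 := abs_le.1 (abs_eval_sub_le hpm (x := xm) (y := x)
          ⟨by linarith [hxm.1], by linarith [hxm.2]⟩
          ⟨by linarith [hxm.1, hx.1], by linarith [hxm.2, hx.2]⟩)
        have h2 : r * coeffNorm r pm * |x - xm| ≤ r * coeffNorm r pm * (c₁ / (2 * (r + 1))) := by
          gcongr
          rw [abs_of_nonneg (by linarith [hx.1])]
          linarith [hx.2]
        have h3 : r * coeffNorm r pm * (c₁ / (2 * (r + 1))) ≤ c₁ / 2 * coeffNorm r pm := by
          have : (r : ℝ) / (r + 1) ≤ 1 := (div_le_one (by positivity)).2 (by linarith)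
          calc _ = (r : ℝ) / (r + 1) * (c₁ / 2 * coeffNorm r pm) := by field_simp
            _ ≤ 1 * (c₁ / 2 * coeffNorm r pm) := by gcongr
            _ = _ := one_mul _
        have h4 : c₁ / 2 * (K * D) ≤ c₁ / 2 * coeffNorm r pm := by gcongr
        have h5 : c₁ / 2 * (K * D) = 1296 / ρ ^ 2 * D := by
          rw [hK]
          field_simp
        linarith [h1.1])
    refine ⟨v, hmono (mul_le_mul_of_nonneg_right ?_ hD0) hv⟩
    exact le_add_of_nonneg_right (by positivity)
  · obtain ⟨xp, hxp, hxpN⟩ := hlow₂ pp hpp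
    rw [abs_of_nonneg (hp0 xp ⟨by linarith [hxp.1], by linarith [hxp.2]⟩)] at hxpN
    obtain ⟨um, hum1, hum2, hum3⟩ := hsoft δ T hδ0 hT xm (xm + ρ) (by linarith [hxm.1])
      (by linarith [hxm.2]) (by linarith) pm hpm (hcut hρ₁ hxmN)
    obtain ⟨up, hup1, hup2, hup3⟩ := hsoft δ T hδ0 hT xp (xp + ρ) (by linarith [hxp.1])
      (by linarith [hxp.2]) (by linarith) pp hpp (hcut hρ₂ hxpN)
    obtain ⟨g₁, hg₁⟩ := exists_bump hδ0 hT r (a := -1) (b := -(3 / 4)) le_rfl (by norm_num)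
      (by linarith)
    obtain ⟨g₂, hg₂⟩ := exists_bump hδ0 hT r (a := 3 / 4) (b := 1) (by norm_num) le_rfl
      (by linarith)
    obtain ⟨v, hv⟩ := exists_local_correction_of_cutoff hpm hpp hm0 hp0 hκ hκD hdD
      (by linarith [hxm.1]) (by linarith) (by linarith [hxm.2]) (by linarith [hxp.1])
      (by linarith [hxp.2]) ⟨hum1, hum2, hum3⟩ ⟨hup1, hup2, hup3⟩ hg₁ hg₂
    refine ⟨v, hmono ?_ hv⟩
    have h1 : coeffNorm r pp ≤ D + coeffNorm r pm := by
      have := coeffNorm_add_le r (pp - pm) pm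
      rw [sub_add_cancel] at this
      linarith
    have h2 : 0 ≤ 1296 / ρ ^ 2 * D := by positivity
    linarith

/-! ### Integration back to the spline itself -/

theorem hasDerivAt_primitive_truncSpan {r : ℕ} (hr : 1 ≤ r) {T : Set ℝ} {v : ℝ → ℝ}
    (hv : v ∈ truncSpan r T) (a x : ℝ) : HasDerivAt (fun x => ∫ y in a..x, v y) (v x) x :=
  intervalIntegral.integral_hasDerivAt_right (truncSpan_intervalIntegrable hv a x)
    ((truncSpan_continuous hr hv).stronglyMeasurableAtFilter _ _)
    (truncSpan_continuous hr hv).continuousAt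

theorem abs_primitive_le {v : ℝ → ℝ} {B : ℝ} (hB : ∀ x ∈ Icc (-1 : ℝ) 1, |v x| ≤ B) :
    ∀ x ∈ Icc (-1 : ℝ) 1, |∫ y in (-1 : ℝ)..x, v y| ≤ 2 * B := fun x hx => by
  have h := abs_integral_le_of_abs_le (f := v) hx.1 fun y hy => hB y ⟨hy.1, hy.2.trans hx.2⟩
  have hB0 : 0 ≤ B := (abs_nonneg _).trans (hB 0 (by norm_num))
  have : B * (x - -1) ≤ B * 2 := by
    gcongr
    linarith [hx.2]
  linarith

theorem integral_derivative (e : Polynomial ℝ) (a b : ℝ) :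
    ∫ x in a..b, e.derivative.eval x = e.eval b - e.eval a :=
  intervalIntegral.integral_eq_sub_of_hasDerivAt (f := fun y => e.eval y)
    (fun y _ => e.hasDerivAt y) (e.derivative.continuous.intervalIntegrable _ _)

theorem primitive_eq_eval {v : ℝ → ℝ} (hint : ∀ a b, IntervalIntegrable v volume a b)
    {e : Polynomial ℝ} (hr : ∀ x, 1 ≤ x → v x = e.derivative.eval x)
    (h1 : ∫ y in (-1 : ℝ)..1, v y = e.eval 1) :
    ∀ x, 1 ≤ x → ∫ y in (-1 : ℝ)..x, v y = e.eval x := fun x hx => by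
  have h2 : ∫ y in (1 : ℝ)..x, v y = e.eval x - e.eval 1 := by
    rw [← integral_derivative]
    refine intervalIntegral.integral_congr fun y hy => ?_
    rw [uIcc_of_le hx] at hy
    exact hr y hy.1
  rw [← intervalIntegral.integral_add_adjacent_intervals (hint _ 1) (hint 1 _), h1, h2]
  ring

/-- The condition on the jump `d` at `z` under which `q`-monotonicity passes through `z`. -/
def JumpNonneg (q : ℕ) (d : Polynomial ℝ) (z : ℝ) : Prop :=
  (∀ i < q - 1, (Polynomial.derivative^[i] d).eval z = 0) ∧
    0 ≤ (Polynomial.derivative^[q - 1] d).eval z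

theorem abs_coeff_le_coeffNorm {r i : ℕ} (hi : i ≤ r) (p : Polynomial ℝ) :
    |p.coeff i| ≤ coeffNorm r p :=
  Finset.single_le_sum (f := fun i => |p.coeff i|) (fun _ _ => abs_nonneg _)
    (Finset.mem_range.2 (Nat.lt_succ_of_le hi))

theorem contDiff_eval (n : WithTop ℕ∞) (P : Polynomial ℝ) : ContDiff ℝ n fun x => P.eval x := by
  simp only [Polynomial.eval_eq_sum_range]
  fun_prop

/-- The point mass is κ = d^(q-1)(0), so the prescribed mass equals d^(q-1)(1) and the first
primitive meets d^(q-1) at 1. For q = 2 the prescribed moment, together with d(0) = 0, makes the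
second primitive meet d at 1. -/
theorem exists_local_spline_aux {r : ℕ} (hr : 1 ≤ r) {q : ℕ} (hq : q = 1 ∨ q = 2) :
    ∃ δ : ℝ, 0 < δ ∧ ∃ C : ℝ, 0 ≤ C ∧ ∀ T : Set ℝ, MeshDense δ T →
    ∀ Pm Pp : Polynomial ℝ, Pm.natDegree ≤ q + r → Pp.natDegree ≤ q + r →
    (∀ x ∈ Icc (-1 : ℝ) 0, 0 ≤ (Polynomial.derivative^[q] Pm).eval x) →
    (∀ x ∈ Icc (0 : ℝ) 1, 0 ≤ (Polynomial.derivative^[q] Pp).eval x) →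
    JumpNonneg q (Pp - Pm) 0 →
    ∃ V ∈ truncSpan (q + r) (T ∩ Ioo (-1) 1), (∀ x, 1 ≤ x → V x = (Pp - Pm).eval x) ∧
      (∀ x ∈ Icc (-1 : ℝ) 1, |V x| ≤ C * coeffNorm (q + r) (Pp - Pm)) ∧
      ∀ x ∈ Icc (-1 : ℝ) 1, 0 ≤ iteratedDeriv q (fun x => Pm.eval x + V x) x := by
  obtain ⟨δ, hδ, C, hC, hloc⟩ := exists_local_correction r
  -- Each of at most two integrations over [-1, 1] costs a factor 2; (r + 1)(r + 2) is the cost of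
  -- two differentiations in the coefficient norm and also covers q = 1.
  refine ⟨δ, hδ, 4 * C * ((r + 1) * (r + 2)), by positivity, ?_⟩
  intro T hT Pm Pp hPm hPp hm hp hjump
  have hsub : T ∩ Ioo (-1 : ℝ) 1 ⊆ Ioi (-1) := inter_Ioo_subset_Ioi T (-1) 1
  set d := Pp - Pm with hd
  have hrr : (1 : ℝ) ≤ r := by exact_mod_cast hr
  rcases hq with rfl | rfl
  · set N := coeffNorm (1 + r) d with hN
    have hN0 : 0 ≤ N := coeffNorm_nonneg _ _
    simp only [Function.iterate_one] at hm hp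
    have h0 : 0 ≤ d.eval 0 := by simpa using hjump.2
    have hκ : d.eval 0 ≤ (r + 1) * (r + 2) * N := by
      have h := abs_coeff_le_coeffNorm (r := 1 + r) (Nat.zero_le _) d
      rw [Polynomial.coeff_zero_eq_eval_zero] at h
      have : N ≤ (r + 1) * (r + 2) * N := le_mul_of_one_le_left hN0 (by nlinarith)
      exact (le_abs_self _).trans (h.trans this)
    have hdd : Pp.derivative - Pm.derivative = d.derivative := by simp [hd]
    have hdN : coeffNorm r (Pp.derivative - Pm.derivative) ≤ (r + 1) * (r + 2) * N := by
      rw [hdd]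
      have h := coeffNorm_derivative_le r d
      rw [add_comm r 1] at h
      refine h.trans ?_
      gcongr
      nlinarith
    obtain ⟨v, hv⟩ := hloc T hT Pm.derivative Pp.derivative
      (natDegree_derivative_le_of_le (by omega)) (natDegree_derivative_le_of_le (by omega)) hm hp
      (d.eval 0) ((r + 1) * (r + 2) * N) h0 hκ hdN
    have hint := truncSpan_intervalIntegrable hv.mem
    have hright := hv.right
    have hmass := hv.mass
    rw [hdd] at hright hmass
    rw [integral_derivative] at hmass
    refine ⟨fun x => ∫ y in (-1 : ℝ)..x, v y, ?_, ?_, fun x hx => ?_, fun x hx => ?_⟩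
    · rw [add_comm]
      exact primitive_mem_truncSpan hsub hv.mem
    · exact primitive_eq_eval hint hright (by rw [hmass]; ring)
    · refine (abs_primitive_le hv.bound x hx).trans ?_
      have : 0 ≤ C * ((r + 1) * (r + 2) * N) := by positivity
      linarith
    · rw [iteratedDeriv_one,
        ((Pm.hasDerivAt x).fun_add (hasDerivAt_primitive_truncSpan hr hv.mem (-1) x)).deriv]
      exact hv.nonneg x hx
  · set N := coeffNorm (2 + r) d with hN
    have hN0 : 0 ≤ N := coeffNorm_nonneg _ _
    simp only [Function.iterate_succ, Function.iterate_zero, Function.comp_apply, id_eq] at hm hp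
    have h00 : d.eval 0 = 0 := hjump.1 0 (by norm_num)
    have h0 : 0 ≤ d.derivative.eval 0 := by simpa using hjump.2
    have hκ : d.derivative.eval 0 ≤ (r + 1) * (r + 2) * N := by
      have h := abs_coeff_le_coeffNorm (r := 2 + r) (i := 1) (by omega) d
      have e : d.derivative.eval 0 = d.coeff 1 := by
        rw [← Polynomial.coeff_zero_eq_eval_zero, Polynomial.coeff_derivative]
        simp
      rw [← e] at h
      have : N ≤ (r + 1) * (r + 2) * N := le_mul_of_one_le_left hN0 (by nlinarith)
      exact (le_abs_self _).trans (h.trans this)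
    have hdd : Pp.derivative.derivative - Pm.derivative.derivative = d.derivative.derivative := by
      simp [hd]
    have hdN : coeffNorm r (Pp.derivative.derivative - Pm.derivative.derivative) ≤
        (r + 1) * (r + 2) * N := by
      rw [hdd]
      have h := coeffNorm_derivative_le r d.derivative
      have h' := coeffNorm_derivative_le (r + 1) d
      rw [show r + 1 + 1 = 2 + r by ring] at h'
      push_cast at h'
      calc _ ≤ _ := h
        _ ≤ (r + 1) * ((r + 1 + 1) * N) := by gcongr
        _ = _ := by ring
    obtain ⟨v, hv⟩ := hloc T hT Pm.derivative.derivative Pp.derivative.derivative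
      (natDegree_derivative_le_of_le (natDegree_derivative_le_of_le (by omega)))
      (natDegree_derivative_le_of_le (natDegree_derivative_le_of_le (by omega))) hm hp
      (d.derivative.eval 0) ((r + 1) * (r + 2) * N) h0 hκ hdN
    have hint := truncSpan_intervalIntegrable hv.mem
    have hright := hv.right
    have hmass := hv.mass
    have hmom := hv.moment
    rw [hdd] at hright hmass hmom
    rw [integral_derivative] at hmass
    have hWmem := primitive_mem_truncSpan hsub hv.mem
    set W : ℝ → ℝ := fun x => ∫ y in (-1 : ℝ)..x, v y with hW
    have hWd : ∀ x, HasDerivAt W (v x) x := fun x =>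
      hasDerivAt_primitive_truncSpan hr hv.mem (-1) x
    have hWr : ∀ x, 1 ≤ x → W x = d.derivative.eval x :=
      primitive_eq_eval hint hright (by rw [hmass]; ring)
    have hWint := truncSpan_intervalIntegrable hWmem
    -- Integrate by parts twice: ∫W = W(1) - ∫xv, and the moment is ∫₀¹ x d'' = d'(1) - d(1) + d(0).
    -- With W(1) = d'(1) and d(0) = 0 this leaves d(1).
    have hWmass : ∫ y in (-1 : ℝ)..1, W y = d.eval 1 := by
      have h1 := intervalIntegral.integral_mul_deriv_eq_deriv_mul (a := -1) (b := 1)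
        (u := fun x => x) (u' := fun _ => 1) (v := W) (v' := v) (fun x _ => hasDerivAt_id x)
        (fun x _ => hWd x) intervalIntegrable_const (hint _ _)
      have h2 := intervalIntegral.integral_mul_deriv_eq_deriv_mul (a := 0) (b := 1)
        (u := fun x => x) (u' := fun _ => 1) (v := fun x => d.derivative.eval x)
        (v' := fun x => d.derivative.derivative.eval x) (fun x _ => hasDerivAt_id x)
        (fun x _ => d.derivative.hasDerivAt x) intervalIntegrable_const
        (d.derivative.derivative.continuous.intervalIntegrable _ _)
      have hW1 : W (-1) = 0 := truncSpan_eq_zero hsub hWmem _ le_rfl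
      simp only [one_mul, hW1, mul_zero, sub_zero, zero_mul] at h1 h2
      rw [hmom, h2, integral_derivative, h00, hWr 1 le_rfl] at h1
      linarith
    have hVd : ∀ x, HasDerivAt (fun x => ∫ y in (-1 : ℝ)..x, W y) (W x) x := fun x =>
      hasDerivAt_primitive_truncSpan (by omega) hWmem (-1) x
    refine ⟨fun x => ∫ y in (-1 : ℝ)..x, W y, ?_, ?_, fun x hx => ?_, fun x hx => ?_⟩
    · rw [show 2 + r = r + 1 + 1 by ring]
      exact primitive_mem_truncSpan hsub hWmem
    · exact primitive_eq_eval hWint hWr hWmass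
    · refine (abs_primitive_le (abs_primitive_le hv.bound) x hx).trans_eq ?_
      ring
    · have e : deriv (fun x => Pm.eval x + ∫ y in (-1 : ℝ)..x, W y) =
          fun x => Pm.derivative.eval x + W x :=
        funext fun x => ((Pm.hasDerivAt x).add (hVd x)).deriv
      rw [iteratedDeriv_succ', e, iteratedDeriv_one,
        ((Pm.derivative.hasDerivAt x).fun_add (hWd x)).deriv]
      exact hv.nonneg x hx

/-! ### Rescaling to a knot -/

/-- The polynomial `y ↦ P (z + a y)`. -/
noncomputable def rescale (a z : ℝ) (P : Polynomial ℝ) : Polynomial ℝ :=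
  P.comp (Polynomial.C a * Polynomial.X + Polynomial.C z)

theorem rescale_eval (a z : ℝ) (P : Polynomial ℝ) (y : ℝ) :
    (rescale a z P).eval y = P.eval (z + a * y) := by
  simp [rescale, Polynomial.eval_comp, add_comm]

theorem rescale_sub (a z : ℝ) (P Q : Polynomial ℝ) :
    rescale a z (P - Q) = rescale a z P - rescale a z Q := by
  simp [rescale]

theorem rescale_natDegree_le {k : ℕ} (a z : ℝ) {P : Polynomial ℝ} (hP : P.natDegree ≤ k) :
    (rescale a z P).natDegree ≤ k := by
  refine Polynomial.natDegree_comp_le.trans ?_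
  calc _ ≤ P.natDegree * 1 := Nat.mul_le_mul_left _ Polynomial.natDegree_linear_le
    _ ≤ k := by omega

theorem iterate_derivative_rescale (a z : ℝ) (P : Polynomial ℝ) (i : ℕ) (y : ℝ) :
    (Polynomial.derivative^[i] (rescale a z P)).eval y =
      a ^ i * (Polynomial.derivative^[i] P).eval (z + a * y) := by
  have : Polynomial.derivative^[i] (rescale a z P) =
      Polynomial.C (a ^ i) * rescale a z (Polynomial.derivative^[i] P) := by
    induction i with
    | zero => simp
    | succ i ih =>
      rw [Function.iterate_succ_apply', ih, Function.iterate_succ_apply']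
      simp only [rescale, Polynomial.derivative_C_mul, Polynomial.derivative_comp,
        Polynomial.derivative_add, Polynomial.derivative_X, Polynomial.derivative_C, mul_one,
        add_zero, pow_succ, Polynomial.C_mul]
      ring
  rw [this, Polynomial.eval_mul, Polynomial.eval_C, rescale_eval]

theorem JumpNonneg.rescale {q : ℕ} {d : Polynomial ℝ} {z a : ℝ} (ha : 0 < a)
    (h : JumpNonneg q d z) : JumpNonneg q (rescale a z d) 0 := by
  refine ⟨fun i hi => ?_, ?_⟩
  · rw [iterate_derivative_rescale, mul_zero, add_zero, h.1 i hi, mul_zero]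
  · rw [iterate_derivative_rescale, mul_zero, add_zero]
    exact mul_nonneg (by positivity) h.2

/-- Local smoothing of a two-piece polynomial at `z`, within `(z - a, z + a)`. -/
theorem exists_local_spline {r : ℕ} (hr : 1 ≤ r) {q : ℕ} (hq : q = 1 ∨ q = 2) :
    ∃ δ : ℝ, 0 < δ ∧ ∃ C : ℝ, 0 ≤ C ∧ ∀ (T : Set ℝ) (a z : ℝ), 0 < a →
    (∀ x, z - a ≤ x → x + δ * a ≤ z + a → ∃ τ ∈ T, τ ∈ Ioo x (x + δ * a)) →
    ∀ Pm Pp : Polynomial ℝ, Pm.natDegree ≤ q + r → Pp.natDegree ≤ q + r →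
    (∀ x ∈ Icc (z - a) z, 0 ≤ (Polynomial.derivative^[q] Pm).eval x) →
    (∀ x ∈ Icc z (z + a), 0 ≤ (Polynomial.derivative^[q] Pp).eval x) →
    JumpNonneg q (Pp - Pm) z →
    ∃ V ∈ truncSpan (q + r) (T ∩ Ioo (z - a) (z + a)),
      (∀ x, z + a ≤ x → V x = (Pp - Pm).eval x) ∧
      (∀ x ∈ Icc (z - a) (z + a), |V x| ≤ C * coeffNorm (q + r) (rescale a z (Pp - Pm))) ∧
      ∀ x ∈ Icc (z - a) (z + a), 0 ≤ iteratedDeriv q (fun x => Pm.eval x + V x) x := by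
  obtain ⟨δ, hδ, C, hC, hloc⟩ := exists_local_spline_aux hr hq
  refine ⟨δ, hδ, C, hC, ?_⟩
  intro T a z ha hT Pm Pp hPm hPp hm hp hjump
  -- The normalised problem is solved on the preimage of the mesh under y ↦ z + a y, and its
  -- solution is transported back.
  have hdense : MeshDense δ {y | z + a * y ∈ T} := by
    intro x hx hxδ
    obtain ⟨τ, hτT, hτ⟩ := hT (z + a * x) (by nlinarith) (by nlinarith)
    have e : z + a * ((τ - z) / a) = τ := by
      field_simp
      ring
    refine ⟨(τ - z) / a, by rwa [mem_ofPred_eq, e], ?_, ?_⟩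
    · rw [lt_div_iff₀ ha]
      linarith [hτ.1]
    · rw [div_lt_iff₀ ha]
      linarith [hτ.2]
  have hscale : ∀ y, (-1 : ℝ) ≤ y → y ≤ 1 → z - a ≤ z + a * y ∧ z + a * y ≤ z + a := fun y h1 h2 =>
    ⟨by nlinarith, by nlinarith⟩
  obtain ⟨V, hVmem, hVr, hVb, hVd⟩ := hloc _ hdense (rescale a z Pm) (rescale a z Pp)
    (rescale_natDegree_le a z hPm) (rescale_natDegree_le a z hPp)
    (fun x hx => by
      rw [iterate_derivative_rescale]
      exact mul_nonneg (by positivity)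
        (hm _ ⟨(hscale x hx.1 (by linarith [hx.2])).1, by nlinarith [hx.2]⟩))
    (fun x hx => by
      rw [iterate_derivative_rescale]
      exact mul_nonneg (by positivity)
        (hp _ ⟨by nlinarith [hx.1], (hscale x (by linarith [hx.1]) hx.2).2⟩))
    (by rw [← rescale_sub]; exact hjump.rescale ha)
  have hunscale : ∀ x ∈ Icc (z - a) (z + a), (x - z) / a ∈ Icc (-1 : ℝ) 1 := fun x hx =>
    ⟨by rw [le_div_iff₀ ha]; linarith [hx.1], by rw [div_le_iff₀ ha]; linarith [hx.2]⟩
  have hback : ∀ x, z + a * ((x - z) / a) = x := fun x => by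
    field_simp
    ring
  refine ⟨fun x => V ((x - z) / a), truncSpan_comp_affine ha ?_ hVmem, fun x hx => ?_,
    fun x hx => ?_, fun x hx => ?_⟩
  · rintro τ ⟨hτT, hτ⟩
    exact ⟨hτT, by nlinarith [hτ.1], by nlinarith [hτ.2]⟩
  · have h := hVr ((x - z) / a) (by rw [le_div_iff₀ ha]; linarith)
    rwa [← rescale_sub, rescale_eval, hback] at h
  · rw [rescale_sub]
    exact hVb _ (hunscale x hx)
  · have hcd : ContDiff ℝ q (fun y => (rescale a z Pm).eval y + V y) := by
      refine ContDiff.add (contDiff_eval _ _) ?_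
      obtain ⟨k, rfl⟩ := Nat.exists_eq_add_of_le' hr
      rw [← add_assoc] at hVmem
      exact (truncSpan_contDiff hVmem).of_le (by exact_mod_cast Nat.le_add_right q k)
    have e : (fun x => Pm.eval x + V ((x - z) / a)) = fun x =>
        (fun w => (fun y => (rescale a z Pm).eval y + V y) (a⁻¹ * w)) (x - z) := by
      ext x
      simp only [rescale_eval, ← div_eq_inv_mul, hback]
    rw [e, iteratedDeriv_comp_sub_const q
      (fun w => (fun y => (rescale a z Pm).eval y + V y) (a⁻¹ * w)) z, iteratedDeriv_comp_const_mul hcd]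
    refine mul_nonneg (by positivity) ?_
    rw [← div_eq_inv_mul]
    exact hVd _ (hunscale x hx)

/-! ### q-monotonicity, derivatives and jumps -/

theorem dividedDifference_two (f : ℝ → ℝ) (t : Fin (1 + 1) → ℝ) :
    dividedDifference f t = f (t 0) / (t 0 - t 1) + f (t 1) / (t 1 - t 0) := by
  have h0 : Finset.univ.erase (0 : Fin 2) = {1} := by decide
  have h1 : Finset.univ.erase (1 : Fin 2) = {0} := by decide
  simp [dividedDifference, Fin.sum_univ_two, h0, h1]

theorem dividedDifference_three (f : ℝ → ℝ) (t : Fin (2 + 1) → ℝ) :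
    dividedDifference f t = f (t 0) / ((t 0 - t 1) * (t 0 - t 2)) +
      f (t 1) / ((t 1 - t 0) * (t 1 - t 2)) + f (t 2) / ((t 2 - t 0) * (t 2 - t 1)) := by
  have h0 : Finset.univ.erase (0 : Fin 3) = {1, 2} := by decide
  have h1 : Finset.univ.erase (1 : Fin 3) = {0, 2} := by decide
  have h2 : Finset.univ.erase (2 : Fin 3) = {0, 1} := by decide
  simp [dividedDifference, Fin.sum_univ_three, h0, h1, h2]

theorem qMonotoneOn_one_iff {f : ℝ → ℝ} {J : Set ℝ} : QMonotoneOn 1 f J ↔ MonotoneOn f J := by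
  have key : ∀ x y : ℝ, f x / (x - y) + f y / (y - x) = (f y - f x) / (y - x) := fun x y => by
    rw [← neg_sub y x, div_neg]
    ring
  constructor
  · intro h x hx y hy hxy
    rcases hxy.lt_or_eq with hlt | rfl
    · have := h ![x, y] (by
        intro i j hij
        fin_cases i <;> fin_cases j <;> simp_all [hlt.ne, hlt.ne'])
        (by intro i; fin_cases i <;> simpa)
      rw [dividedDifference_two] at this
      simp only [Matrix.cons_val_zero, Matrix.cons_val_one, key] at this
      have h2 := (le_div_iff₀ (sub_pos.2 hlt)).1 this
      linarith
    · exact le_rfl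
  · intro h t ht hJ
    rw [dividedDifference_two, key]
    rcases le_total (t 0) (t 1) with hle | hle
    · exact div_nonneg (sub_nonneg.2 (h (hJ 0) (hJ 1) hle)) (sub_nonneg.2 hle)
    · exact div_nonneg_of_nonpos (sub_nonpos.2 (h (hJ 1) (hJ 0) hle)) (sub_nonpos.2 hle)

/-- For ordered points the divided difference is the increase of adjacent slopes divided by the
total length, so its sign is the slope criterion for convexity. Symmetry in the points reduces every
order to this one. -/
theorem qMonotoneOn_two_iff {f : ℝ → ℝ} {J : Set ℝ} (hJ : Convex ℝ J) :
    QMonotoneOn 2 f J ↔ ConvexOn ℝ J f := by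
  have key : ∀ x y w : ℝ, x < y → y < w → f x / ((x - y) * (x - w)) + f y / ((y - x) * (y - w)) +
      f w / ((w - x) * (w - y)) =
        ((f w - f y) / (w - y) - (f y - f x) / (y - x)) / (w - x) := fun x y w h1 h2 => by
    have e1 : y - x ≠ 0 := by linarith
    have e2 : w - y ≠ 0 := by linarith
    have e3 : w - x ≠ 0 := by linarith
    have e4 : x - y ≠ 0 := by linarith
    have e5 : y - w ≠ 0 := by linarith
    have e6 : x - w ≠ 0 := by linarith
    field_simp
    ring
  constructor
  · intro h
    refine convexOn_of_slope_mono_adjacent hJ fun {x y w} hx hw hxy hyw => ?_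
    have hy : y ∈ J := hJ.ordConnected.out hx hw ⟨hxy.le, hyw.le⟩
    have hxw := hxy.trans hyw
    have := h ![x, y, w] (by
      intro i j hij
      fin_cases i <;> fin_cases j <;>
        simp_all [hxy.ne, hxy.ne', hyw.ne, hyw.ne', hxw.ne, hxw.ne'])
      (by intro i; fin_cases i <;> simpa)
    rw [dividedDifference_three] at this
    have h2 : 0 ≤ f x / ((x - y) * (x - w)) + f y / ((y - x) * (y - w)) +
      f w / ((w - x) * (w - y)) := this
    rw [key x y w hxy hyw] at h2
    have h3 := (le_div_iff₀ (sub_pos.2 hxw)).1 h2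
    linarith
  · intro h t ht hmem
    have hpos : ∀ x y w : ℝ, x ∈ J → w ∈ J → x < y → y < w →
        0 ≤ f x / ((x - y) * (x - w)) + f y / ((y - x) * (y - w)) +
          f w / ((w - x) * (w - y)) := fun x y w hx hw h1 h2 => by
      rw [key x y w h1 h2]
      exact div_nonneg (sub_nonneg.2 (h.slope_mono_adjacent hx hw h1 h2)) (by linarith)
    rw [dividedDifference_three]
    have h01 : t 0 ≠ t 1 := ht.ne (by decide)
    have h02 : t 0 ≠ t 2 := ht.ne (by decide)
    have h12 : t 1 ≠ t 2 := ht.ne (by decide)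
    -- Of the eight sign patterns, six are the orderings of three points and two are contradictory
    -- cycles.
    rcases h01.lt_or_gt with a | a <;> rcases h02.lt_or_gt with b | b <;>
      rcases h12.lt_or_gt with c | c
    · exact hpos _ _ _ (hmem 0) (hmem 2) a c
    · exact (hpos _ _ _ (hmem 0) (hmem 1) b c).trans_eq (by ring)
    · linarith
    · exact (hpos _ _ _ (hmem 2) (hmem 1) b a).trans_eq (by ring)
    · exact (hpos _ _ _ (hmem 1) (hmem 2) a b).trans_eq (by ring)
    · linarith
    · exact (hpos _ _ _ (hmem 1) (hmem 0) c b).trans_eq (by ring)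
    · exact (hpos _ _ _ (hmem 2) (hmem 0) c a).trans_eq (by ring)

theorem iteratedDeriv_eval (P : Polynomial ℝ) (q : ℕ) :
    iteratedDeriv q (fun x => P.eval x) = fun x => (Polynomial.derivative^[q] P).eval x := by
  induction q generalizing P with
  | zero => simp
  | succ q ih =>
    have : deriv (fun x => P.eval x) = fun x => P.derivative.eval x := funext fun x => P.deriv
    rw [iteratedDeriv_succ', this, ih, Function.iterate_succ_apply]

theorem qMonotoneOn_of_iteratedDeriv_nonneg {q : ℕ} (hq : q = 1 ∨ q = 2) {f : ℝ → ℝ} {a b : ℝ}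
    (hf : ContDiff ℝ q f) (h : ∀ x ∈ Icc a b, 0 ≤ iteratedDeriv q f x) :
    QMonotoneOn q f (Icc a b) := by
  rcases hq with rfl | rfl
  · rw [qMonotoneOn_one_iff]
    refine monotoneOn_of_deriv_nonneg (convex_Icc a b) hf.continuous.continuousOn
      (hf.differentiable (by simp)).differentiableOn fun x hx => ?_
    rw [← iteratedDeriv_one]
    exact h x (interior_subset hx)
  · rw [qMonotoneOn_two_iff (convex_Icc a b)]
    have h1 : ContDiff ℝ 1 (deriv f) := by
      have : ContDiff ℝ (1 + 1) f := by
        convert hf using 1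
        norm_num
      exact (contDiff_succ_iff_deriv.1 this).2.2
    refine convexOn_of_deriv2_nonneg (convex_Icc a b) hf.continuous.continuousOn
      (hf.differentiable (by simp)).differentiableOn
      (h1.differentiable (by simp)).differentiableOn fun x hx => ?_
    rw [← iteratedDeriv_eq_iterate]
    exact h x (interior_subset hx)

theorem eval_nonneg_Icc_of_Ioo {P : Polynomial ℝ} {a b : ℝ} (hab : a < b)
    (h : ∀ x ∈ Ioo a b, 0 ≤ P.eval x) : ∀ x ∈ Icc a b, 0 ≤ P.eval x := by
  rw [← closure_Ioo hab.ne]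
  exact fun x hx => closure_minimal (t := {x | 0 ≤ P.eval x}) h
    (isClosed_le continuous_const P.continuous) hx

theorem derivative_eval_nonneg_of_monotoneOn {P : Polynomial ℝ} {a b : ℝ}
    (h : MonotoneOn (fun x => P.eval x) (Ioo a b)) : ∀ x ∈ Ioo a b, 0 ≤ P.derivative.eval x :=
  fun x hx => by
    have h1 := h.derivWithin_nonneg (x := x)
    rwa [derivWithin_of_mem_nhds (isOpen_Ioo.mem_nhds hx), Polynomial.deriv] at h1

/-- The `q`-th derivative of a polynomial piece of a `q`-monotone function is nonnegative. -/
theorem iterate_derivative_nonneg_of_qMonotoneOn {q : ℕ} (hq : q = 1 ∨ q = 2) {s : ℝ → ℝ}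
    {J : Set ℝ} (hJ : Convex ℝ J) (hs : QMonotoneOn q s J) {P : Polynomial ℝ} {a b : ℝ}
    (hab : a < b) (hsub : Ioo a b ⊆ J) (hP : ∀ x ∈ Ioo a b, s x = P.eval x) :
    ∀ x ∈ Icc a b, 0 ≤ (Polynomial.derivative^[q] P).eval x := by
  refine eval_nonneg_Icc_of_Ioo hab ?_
  rcases hq with rfl | rfl
  · rw [qMonotoneOn_one_iff] at hs
    exact derivative_eval_nonneg_of_monotoneOn ((hs.mono hsub).congr hP)
  · rw [qMonotoneOn_two_iff hJ] at hs
    have h1 : ConvexOn ℝ (Ioo a b) fun x => P.eval x :=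
      (hs.subset hsub (convex_Ioo a b)).congr hP
    have h2 := h1.monotoneOn_deriv fun x _ => P.differentiable x
    have h3 : deriv (fun x => P.eval x) = fun x => P.derivative.eval x :=
      funext fun x => P.deriv
    rw [h3] at h2
    exact derivative_eval_nonneg_of_monotoneOn h2

/-- The jump condition at a knot of a `q`-monotone piecewise polynomial. -/
theorem jumpNonneg_of_qMonotoneOn {q : ℕ} (hq : q = 1 ∨ q = 2) {s : ℝ → ℝ} {A B : ℝ}
    (hs : QMonotoneOn q s (Icc A B)) {Pm Pp : Polynomial ℝ} {a z b : ℝ} (hAa : A ≤ a)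
    (haz : a < z) (hzb : z < b) (hbB : b ≤ B) (hPm : ∀ x ∈ Ioo a z, s x = Pm.eval x)
    (hPp : ∀ x ∈ Ioo z b, s x = Pp.eval x) : JumpNonneg q (Pp - Pm) z := by
  have hzJ : z ∈ Icc A B := ⟨by linarith, by linarith⟩
  have hmJ : ∀ x ∈ Ioo a z, x ∈ Icc A B := fun x hx => ⟨by linarith [hx.1], by linarith [hx.2]⟩
  have hpJ : ∀ x ∈ Ioo z b, x ∈ Icc A B := fun x hx => ⟨by linarith [hx.1], by linarith [hx.2]⟩
  have hleft : ∀ᶠ x in nhdsWithin z (Iio z), x ∈ Ioo a z := Ioo_mem_nhdsLT haz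
  have hright : ∀ᶠ x in nhdsWithin z (Ioi z), x ∈ Ioo z b := Ioo_mem_nhdsGT hzb
  have htm : Filter.Tendsto (fun x => Pm.eval x) (nhdsWithin z (Iio z)) (nhds (Pm.eval z)) :=
    Pm.continuous.continuousAt.tendsto.mono_left nhdsWithin_le_nhds
  have htp : Filter.Tendsto (fun x => Pp.eval x) (nhdsWithin z (Ioi z)) (nhds (Pp.eval z)) :=
    Pp.continuous.continuousAt.tendsto.mono_left nhdsWithin_le_nhds
  rcases hq with rfl | rfl
  · rw [qMonotoneOn_one_iff] at hs
    -- The value of s at the knot is not tied to either piece; monotonicity only places it between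
    -- the two one-sided limits.
    have h1 : Pm.eval z ≤ s z := le_of_tendsto htm (hleft.mono fun x hx => by
      rw [← hPm x hx]
      exact hs (hmJ x hx) hzJ hx.2.le)
    have h2 : s z ≤ Pp.eval z := ge_of_tendsto htp (hright.mono fun x hx => by
      rw [← hPp x hx]
      exact hs hzJ (hpJ x hx) hx.1.le)
    refine ⟨fun i hi => absurd hi (by omega), ?_⟩
    simp only [Nat.sub_self, Function.iterate_zero, id_eq, Polynomial.eval_sub]
    linarith
  · rw [qMonotoneOn_two_iff (convex_Icc A B)] at hs
    -- A convex function is continuous at interior points, which removes the jump in value;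
    -- comparing chords from the two sides in the limit then orders the one-sided derivatives.
    have hcont : ContinuousAt s z := by
      have h1 := hs.continuousOn_interior
      rw [interior_Icc] at h1
      exact h1.continuousAt (Ioo_mem_nhds (by linarith) (by linarith))
    have hm : Pm.eval z = s z := by
      refine tendsto_nhds_unique htm ?_
      exact (hcont.tendsto.mono_left nhdsWithin_le_nhds).congr' (hleft.mono hPm)
    have hp : Pp.eval z = s z := by
      refine tendsto_nhds_unique htp ?_
      exact (hcont.tendsto.mono_left nhdsWithin_le_nhds).congr' (hright.mono hPp)
    have hslope : ∀ x ∈ Ioo a z, ∀ y ∈ Ioo z b,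
        slope (fun x => Pm.eval x) z x ≤ slope (fun x => Pp.eval x) z y := by
      intro x hx y hy
      have h := hs.slope_mono_adjacent (hmJ x hx) (hpJ y hy) hx.2 hy.1
      rw [slope_comm, slope_def_field, slope_def_field, hm, hp, ← hPm x hx, ← hPp y hy]
      exact h
    have htm' : Filter.Tendsto (slope (fun x => Pm.eval x) z) (nhdsWithin z (Iio z))
        (nhds (Pm.derivative.eval z)) :=
      (hasDerivAt_iff_tendsto_slope.1 (Pm.hasDerivAt z)).mono_left
        (nhdsWithin_mono z fun x hx => ne_of_lt hx)
    have htp' : Filter.Tendsto (slope (fun x => Pp.eval x) z) (nhdsWithin z (Ioi z))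
        (nhds (Pp.derivative.eval z)) :=
      (hasDerivAt_iff_tendsto_slope.1 (Pp.hasDerivAt z)).mono_left
        (nhdsWithin_mono z fun x hx => ne_of_gt hx)
    have hle : Pm.derivative.eval z ≤ Pp.derivative.eval z :=
      le_of_tendsto htm' (hleft.mono fun x hx => ge_of_tendsto htp' (hright.mono fun y hy =>
        hslope x hx y hy))
    refine ⟨fun i hi => ?_, ?_⟩
    · obtain rfl : i = 0 := by omega
      simp [hm, hp]
    · simp only [Nat.add_one_sub_one, Function.iterate_one, Polynomial.derivative_sub,
        Polynomial.eval_sub]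
      linarith

/-- Two functions of class `C^q` that agree on an open set have the same derivatives of order `q`
on its closure. -/
theorem iteratedDeriv_eqOn_closure {q : ℕ} {f g : ℝ → ℝ} (hf : ContDiff ℝ q f)
    (hg : ContDiff ℝ q g) {U : Set ℝ} (hU : IsOpen U) (h : EqOn f g U) :
    EqOn (iteratedDeriv q f) (iteratedDeriv q g) (closure U) := by
  refine EqOn.closure (fun x hx => ?_) (hf.continuous_iteratedDeriv q le_rfl)
    (hg.continuous_iteratedDeriv q le_rfl)
  exact ((h.eventuallyEq_of_mem (hU.mem_nhds hx)).iteratedDeriv q).eq_of_nhds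

/-! ### The modulus of smoothness and the jump -/

theorem sum_choose_mul_eval_eq_zero {k : ℕ} {P : Polynomial ℝ} (hP : P.natDegree ≤ k) (x h : ℝ) :
    ∑ i ∈ Finset.range (k + 1 + 1), ((k + 1).choose i : ℝ) * (-1) ^ (k + 1 - i) *
      P.eval (x + i * h) = 0 := by
  have h1 := congrFun (Polynomial.fwdDiff_iter_eq_zero_of_degree_lt
    (Nat.lt_succ_of_le (rescale_natDegree_le h x hP))) 0
  rw [fwdDiff_iter_eq_sum_shift] at h1
  refine Eq.trans ?_ h1
  refine Finset.sum_congr rfl fun i _ => ?_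
  simp [rescale_eval, mul_comm h]
  exact Or.inl (mul_comm _ _)

/-- Near a knot, the symmetric difference of a two-piece polynomial is the jump polynomial. -/
theorem symmDifference_eq_jump {k : ℕ} {s : ℝ → ℝ} {Pm Pp : Polynomial ℝ}
    (hPm : Pm.natDegree ≤ k) {z a : ℝ} (ha : 0 < a) {J : Set ℝ}
    (hJ : Icc (z - a) (z + a) ⊆ J) (hm : ∀ x ∈ Ioo (z - a) z, s x = Pm.eval x)
    (hp : ∀ x ∈ Ioo z (z + a), s x = Pp.eval x) {y : ℝ}
    (hy : y ∈ Ioo z (z + a / (k + 1))) :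
    symmDifference (k + 1) (a / (k + 1)) s J (y - a / 2) = (Pp - Pm).eval y := by
  have hk : (0 : ℝ) < k + 1 := by positivity
  -- The k + 2 nodes then span exactly [y - a, y]; since y < z + h, only the last one, with
  -- coefficient 1, lies beyond the knot. Replacing s by Pm at all nodes gives zero, so what remains
  -- is Pp - Pm at y.
  set h := a / (k + 1) with hh
  have hh0 : 0 < h := by positivity
  have hkh : ((k + 1 : ℕ) : ℝ) * h = a := by
    push_cast
    rw [hh]
    field_simp
  have hha : h ≤ a := div_le_self ha.le (by linarith [(Nat.cast_nonneg k : (0 : ℝ) ≤ k)])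
  unfold symmDifference
  rw [hkh, if_pos ⟨hJ ⟨by linarith [hy.1], by linarith [hy.2]⟩,
    hJ ⟨by linarith [hy.1], by linarith [hy.2]⟩⟩]
  have hx : y - a / 2 - a / 2 = y - a := by ring
  rw [hx, Finset.sum_range_succ]
  have hzero := sum_choose_mul_eval_eq_zero hPm (y - a) h
  rw [Finset.sum_range_succ, hkh, sub_add_cancel] at hzero
  rw [hkh, sub_add_cancel, hp y ⟨hy.1, by linarith [hy.2]⟩]
  have hsum : ∑ i ∈ Finset.range (k + 1), ((k + 1).choose i : ℝ) * (-1) ^ (k + 1 - i) *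
      s (y - a + i * h) = ∑ i ∈ Finset.range (k + 1), ((k + 1).choose i : ℝ) *
        (-1) ^ (k + 1 - i) * Pm.eval (y - a + i * h) := by
    refine Finset.sum_congr rfl fun i hi => ?_
    have hik : (i : ℝ) ≤ k := by
      exact_mod_cast Nat.lt_succ_iff.1 (Finset.mem_range.1 hi)
    have h1 : (i : ℝ) * h ≤ k * h := by gcongr
    have h2 : (0 : ℝ) ≤ i * h := by positivity
    push_cast at hkh
    rw [hm _ ⟨by linarith [hy.1], by linarith [hy.2]⟩]
  rw [hsum]
  simp only [Nat.choose_self, Nat.sub_self, pow_zero, mul_one, Nat.cast_one, one_mul] at hzero ⊢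
  rw [Polynomial.eval_sub]
  linarith

/-- The modulus of smoothness controls the jump polynomial. -/
theorem exists_coeffNorm_le_modulusOn (k : ℕ) : ∃ c : ℝ, 0 < c ∧ ∃ ρ : ℝ, 0 < ρ ∧
    ∀ (s : ℝ → ℝ) (Pm Pp : Polynomial ℝ), Pm.natDegree ≤ k → Pp.natDegree ≤ k →
    ∀ z a l u : ℝ, 0 < a → l ≤ z - a → z + a ≤ u → (∀ x ∈ Ioo (z - a) z, s x = Pm.eval x) →
    (∀ x ∈ Ioo z (z + a), s x = Pp.eval x) → ∀ p : ℝ≥0∞, 0 < p →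
    ENNReal.ofReal (c * coeffNorm k (rescale a z (Pp - Pm))) *
      ENNReal.ofReal (ρ * a) ^ (1 / p.toReal) ≤ modulusOn (k + 1) s (Icc l u) p := by
  have hk : (0 : ℝ) < k + 1 := by positivity
  have hαβ : 1 / (4 * ((k : ℝ) + 1)) < 1 / (2 * (k + 1)) := by
    apply one_div_lt_one_div_of_lt <;> linarith
  obtain ⟨c, hc, hlow⟩ := exists_coeffNorm_le_abs_eval k hαβ
  -- The first bound keeps [x₀, x₀ + ρ] inside (0, 1/(k + 1)), where the difference isolates the
  -- jump; by the second, the jump polynomial loses at most half of its lower bound there.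
  obtain ⟨ρ, hρ, hρ1, hρ2⟩ : ∃ ρ : ℝ, 0 < ρ ∧ ρ ≤ 1 / (4 * (k + 1)) ∧ ρ ≤ c / (2 * (k + 1)) :=
    ⟨min (1 / (4 * (k + 1))) (c / (2 * (k + 1))), lt_min (by positivity) (by positivity),
      min_le_left _ _, min_le_right _ _⟩
  refine ⟨c / 2, by positivity, ρ, hρ, ?_⟩
  intro s Pm Pp hPm hPp z a l u ha hl hu hm hp p hp0
  have hJ : Icc (z - a) (z + a) ⊆ Icc l u := Icc_subset_Icc hl hu
  set d := rescale a z (Pp - Pm) with hd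
  have hddeg : d.natDegree ≤ k := rescale_natDegree_le a z
    ((Polynomial.natDegree_sub_le Pp Pm).trans (max_le hPp hPm))
  set N := coeffNorm k d with hN
  have hN0 : 0 ≤ N := coeffNorm_nonneg _ _
  obtain ⟨x₀, hx₀, hx₀N⟩ := hlow d hddeg
  have hx₀0 : 0 < x₀ := lt_of_lt_of_le (by positivity) hx₀.1
  have hquart : 1 / (4 * ((k : ℝ) + 1)) = 1 / (k + 1) / 4 := by field_simp
  have hhalf : 1 / (2 * ((k : ℝ) + 1)) = 1 / (k + 1) / 2 := by field_simp
  have hpos : 0 < 1 / ((k : ℝ) + 1) := by positivity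
  have hone : 1 / ((k : ℝ) + 1) ≤ 1 := by
    rw [div_le_one hk]
    linarith [(Nat.cast_nonneg k : (0 : ℝ) ≤ k)]
  have hend : x₀ + ρ < 1 / (k + 1) := by
    have := hx₀.2
    rw [hhalf] at this
    rw [hquart] at hρ1
    linarith
  have hbig : ∀ y ∈ Icc x₀ (x₀ + ρ), c / 2 * N ≤ |d.eval y| := by
    intro y hy
    have h1 := abs_eval_sub_le hddeg (x := y) (y := x₀) ⟨by linarith [hy.1], by linarith [hy.2]⟩
      ⟨by linarith, by linarith⟩
    have h2 : k * N * |x₀ - y| ≤ k * N * (c / (2 * (k + 1))) := by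
      gcongr
      rw [abs_sub_comm, abs_of_nonneg (by linarith [hy.1])]
      linarith [hy.2]
    have h3 : k * N * (c / (2 * (k + 1))) ≤ c / 2 * N := by
      have : (k : ℝ) / (k + 1) ≤ 1 := (div_le_one (by positivity)).2 (by linarith)
      calc _ = (k : ℝ) / (k + 1) * (c / 2 * N) := by field_simp
        _ ≤ 1 * (c / 2 * N) := by gcongr
        _ = _ := one_mul _
    have h4 := abs_sub_abs_le_abs_sub (d.eval x₀) (d.eval y)
    linarith
  -- The shift by a/2 appears because the difference is indexed by its centre, not by its last node.
  set I : Set ℝ := Icc (z + a * x₀ - a / 2) (z + a * (x₀ + ρ) - a / 2) with hI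
  have hax : a * (x₀ + ρ) < a * (1 / (k + 1)) := mul_lt_mul_of_pos_left hend ha
  have hax1 : a * (1 / ((k : ℝ) + 1)) ≤ a * 1 := by gcongr
  have hax0 : 0 < a * x₀ := by positivity
  have hIJ : I ⊆ Icc l u := fun x hx => hJ ⟨by linarith [hx.1], by linarith [hx.2]⟩
  have hvolI : volume I = ENNReal.ofReal (ρ * a) := by
    rw [hI, Real.volume_Icc]
    congr 1
    ring
  have hΔ : ∀ x ∈ I, c / 2 * N ≤ |symmDifference (k + 1) (a / (k + 1)) s (Icc l u) x| := by
    intro x hx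
    have h1 := symmDifference_eq_jump hPm ha hJ hm hp (y := x + a / 2)
      ⟨by linarith [hx.1], by
        have : a / ((k : ℝ) + 1) = a * (1 / (k + 1)) := by ring
        linarith [hx.2]⟩
    rw [add_sub_cancel_right] at h1
    have h2 : z + a * ((x + a / 2 - z) / a) = x + a / 2 := by
      field_simp
      ring
    rw [h1, ← h2, ← rescale_eval]
    refine hbig _ ⟨?_, ?_⟩
    · rw [le_div_iff₀ ha]
      linarith [hx.1]
    · rw [div_le_iff₀ ha]
      linarith [hx.2]
  have hstep : a / ((k : ℝ) + 1) ∈ Ioc 0 (volume.real (Icc l u)) := by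
    refine ⟨by positivity, ?_⟩
    rw [Real.volume_real_Icc_of_le (by linarith)]
    have : a / ((k : ℝ) + 1) = a * (1 / (k + 1)) := by ring
    linarith
  unfold modulusOn modulus
  refine le_trans ?_ (le_iSup₂ (f := fun h (_ : h ∈ Ioc 0 (volume.real (Icc l u))) =>
    lpNorm p (symmDifference (k + 1) h s (Icc l u)) (Icc l u)) _ hstep)
  unfold lpNorm
  refine le_trans ?_ (eLpNorm_mono_measure _ (Measure.restrict_mono hIJ le_rfl))
  have hI0 : volume.restrict I ≠ 0 := by
    rw [Ne, Measure.restrict_eq_zero, hvolI]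
    simpa using mul_pos hρ ha
  -- For p = ∞ one has `p.toReal = 0` and `1 / 0 = 0`, so the length factor becomes 1 and the same
  -- formula gives the supremum norm.
  calc _ = eLpNorm (fun _ : ℝ => c / 2 * N) p (volume.restrict I) := by
        rw [eLpNorm_const _ hp0.ne' hI0, Measure.restrict_apply_univ, hvolI,
          Real.enorm_of_nonneg (by positivity)]
    _ ≤ _ := by
        refine eLpNorm_mono_ae ?_
        refine (ae_restrict_iff' measurableSet_Icc).2 (Filter.Eventually.of_forall fun x hx => ?_)
        rw [Real.norm_of_nonneg (by positivity)]
        exact hΔ x hx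

/-- The `L_p` norm of a function that is bounded on a small interval and vanishes outside. -/
theorem lpNorm_le_of_bound {f : ℝ → ℝ} {J : Set ℝ} {z a B : ℝ} (hB : 0 ≤ B)
    (hin : ∀ᵐ x, x ∈ J → x ∈ Icc (z - a) (z + a) → |f x| ≤ B)
    (hout : ∀ᵐ x, x ∈ J → x ∉ Icc (z - a) (z + a) → f x = 0) (hJ : MeasurableSet J)
    (p : ℝ≥0∞) :
    lpNorm p f J ≤ ENNReal.ofReal B * ENNReal.ofReal (2 * a) ^ (1 / p.toReal) := by
  unfold lpNorm
  calc _ ≤ eLpNorm ((Icc (z - a) (z + a)).indicator fun _ => B) p (volume.restrict J) := by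
        refine eLpNorm_mono_ae ((ae_restrict_iff' hJ).2 ?_)
        filter_upwards [hin, hout] with x h1 h2 hx
        by_cases hI : x ∈ Icc (z - a) (z + a)
        · rw [indicator_of_mem hI, Real.norm_of_nonneg hB]
          exact h1 hx hI
        · rw [h2 hx hI, norm_zero]
          exact norm_nonneg _
    _ ≤ ‖B‖ₑ * (volume.restrict J) (Icc (z - a) (z + a)) ^ (1 / p.toReal) :=
        eLpNorm_indicator_const_le _ _
    _ ≤ _ := by
        rw [Real.enorm_of_nonneg hB]
        gcongr
        refine (Measure.restrict_apply_le _ _).trans_eq ?_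
        rw [Real.volume_Icc]
        congr 1
        ring

/-! ### Knots, windows and mid-intervals -/

namespace KnotPartition

variable {n : ℕ} (z : KnotPartition n)

theorem pt_lt_succ {j : ℕ} (hj : j < n) : z.pt j < z.pt (j + 1) :=
  z.strictMono (by simp only [Fin.mk_lt_mk]; omega)

theorem pt_mono : Monotone z.pt := fun i j hij =>
  z.strictMono.monotone (by simp only [Fin.mk_le_mk]; omega)

theorem pt_zero : z.pt 0 = -1 := by
  rw [← z.first]
  unfold pt
  congr 1

theorem pt_last : z.pt n = 1 := by
  rw [← z.last]
  unfold pt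
  congr 1
  ext
  simp

theorem neg_one_le_pt (j : ℕ) : -1 ≤ z.pt j := z.pt_zero ▸ z.pt_mono (Nat.zero_le j)

theorem pt_le_one (j : ℕ) : z.pt j ≤ 1 := by
  rcases le_total j n with h | h
  · exact z.pt_last ▸ z.pt_mono h
  · have : z.pt j = z.pt n := by
      unfold pt
      congr 2
      omega
    rw [this, z.pt_last]

theorem pt_of_le {j : ℕ} (hj : n ≤ j) : z.pt j = 1 :=
  le_antisymm (z.pt_le_one j) (z.pt_last ▸ z.pt_mono hj)

theorem exists_mem_Ico {x : ℝ} (h0 : -1 ≤ x) (h1 : x < 1) :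
    ∃ l < n, x ∈ Ico (z.pt l) (z.pt (l + 1)) := by
  by_contra! hcon
  have : ∀ l ≤ n, z.pt l ≤ x := by
    intro l
    induction l with
    | zero => exact fun _ => z.pt_zero.trans_le h0
    | succ l ih =>
      intro hl
      by_contra hx
      exact hcon l hl ⟨ih (by omega), not_le.1 hx⟩
  exact absurd (this n le_rfl) (by rw [z.pt_last]; exact not_le.2 h1)

/-- Half of the smaller of the lengths of the two intervals adjacent to the knot `z_{i+1}`. -/
noncomputable def radius (i : ℕ) : ℝ :=
  min (z.pt (i + 1) - z.pt i) (z.pt (i + 1 + 1) - z.pt (i + 1)) / 2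

theorem radius_pos {i : ℕ} (hi : i + 1 < n) : 0 < z.radius i :=
  half_pos (lt_min (sub_pos.2 (z.pt_lt_succ (by omega))) (sub_pos.2 (z.pt_lt_succ hi)))

theorem radius_le_left (i : ℕ) : 2 * z.radius i ≤ z.pt (i + 1) - z.pt i := by
  have := min_le_left (z.pt (i + 1) - z.pt i) (z.pt (i + 1 + 1) - z.pt (i + 1))
  unfold radius
  linarith

theorem radius_le_right (i : ℕ) : 2 * z.radius i ≤ z.pt (i + 1 + 1) - z.pt (i + 1) := by
  have := min_le_right (z.pt (i + 1) - z.pt i) (z.pt (i + 1 + 1) - z.pt (i + 1))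
  unfold radius
  linarith

theorem measurableSet_midInterval (j : ℕ) : MeasurableSet (z.midInterval j) := measurableSet_Icc

/-- Together with `midInterval_left`, this says that the window of one knot does not reach into the
mid-interval of another beyond an endpoint, so at most one correction is active on each
mid-interval. -/
theorem midInterval_right {i j : ℕ} (hij : i + 1 < j) {x : ℝ} (hx : x ∈ z.midInterval j) :
    z.pt (i + 1) + z.radius i ≤ x := by
  have h1 := z.radius_le_right i
  have h2 := z.pt_mono (show i + 1 ≤ j - 1 by omega)
  have h3 := z.pt_mono (show i + 1 + 1 ≤ j by omega)
  linarith [hx.1]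

theorem midInterval_left {i j : ℕ} (hij : j < i + 1) {x : ℝ} (hx : x ∈ z.midInterval j) :
    x ≤ z.pt (i + 1) - z.radius i := by
  have h1 := z.radius_le_left i
  have h2 := z.pt_mono (show j ≤ i by omega)
  have h3 := z.pt_mono (show j + 1 ≤ i + 1 by omega)
  linarith [hx.2]

theorem exists_mem_midInterval {x : ℝ} (h0 : -1 ≤ x) (h1 : x ≤ 1) :
    ∃ j ≤ n, x ∈ z.midInterval j := by
  rcases h1.lt_or_eq with h1 | rfl
  · obtain ⟨l, hl, hx⟩ := z.exists_mem_Ico h0 h1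
    rcases le_total x ((z.pt l + z.pt (l + 1)) / 2) with h | h
    · refine ⟨l, hl.le, ?_, h⟩
      have := z.pt_mono (Nat.sub_le l 1)
      linarith [hx.1]
    · refine ⟨l + 1, hl, ?_, ?_⟩
      · simpa using h
      · have := z.pt_mono (Nat.le_succ (l + 1))
        linarith [hx.2]
  · refine ⟨n, le_rfl, ?_, ?_⟩
    · have := z.pt_le_one (n - 1)
      rw [z.pt_last]
      linarith
    · rw [z.pt_last, z.pt_of_le (Nat.le_succ n)]
      norm_num

theorem midInterval_lt {j : ℕ} (hn : 0 < n) (hj : j ≤ n) :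
    (z.pt (j - 1) + z.pt j) / 2 < (z.pt j + z.pt (j + 1)) / 2 := by
  rcases hj.lt_or_eq with h | rfl
  · have h1 := z.pt_lt_succ h
    have h2 := z.pt_mono (Nat.sub_le j 1)
    linarith
  · have h1 := z.pt_lt_succ (show j - 1 < j by omega)
    rw [show j - 1 + 1 = j by omega] at h1
    have h2 := z.pt_mono (Nat.le_succ j)
    linarith

end KnotPartition

/-- A remesh is dense near the knots of the original partition. -/
theorem IsRemesh.exists_knot {n m : ℕ} {δ : ℝ} (hδ : 0 < δ) {z : KnotPartition n}
    {t : KnotPartition m} (h : IsRemesh (δ / 4) z t) {i : ℕ} (hi : i + 1 < n) {x : ℝ}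
    (hx : z.pt (i + 1) - z.radius i ≤ x)
    (hx' : x + δ * z.radius i ≤ z.pt (i + 1) + z.radius i) :
    ∃ τ ∈ range t.pt, τ ∈ Ioo x (x + δ * z.radius i) := by
  have ha := z.radius_pos hi
  have hl := z.radius_le_left i
  have hr := z.radius_le_right i
  have hδa : 0 < δ * z.radius i := by positivity
  obtain ⟨l, hlm, hxl⟩ := t.exists_mem_Ico (x := x) (by linarith [z.neg_one_le_pt i])
    (by linarith [z.pt_le_one (i + 1 + 1)])
  -- The shorter adjacent interval has length 2 · radius, so the factor δ/4 bounds the mesh length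
  -- by δ/2 · radius, leaving room for a strict inequality at the end.
  have key : ∀ j, j = i ∨ j = i + 1 →
      (Icc (t.pt l) (t.pt (l + 1)) ∩ Ioo (z.pt j) (z.pt (j + 1))).Nonempty →
      t.pt (l + 1) - t.pt l ≤ δ / 2 * z.radius i := by
    intro j hj hne
    have h1 := h j (by omega) l hlm hne i (by omega) (by omega) (by omega)
    have h2 := h j (by omega) l hlm hne (i + 1) (by omega) (by omega) (by omega)
    rw [abs_of_pos (by linarith)] at h1 h2
    have h3 : min (z.pt (i + 1) - z.pt i) (z.pt (i + 1 + 1) - z.pt (i + 1)) =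
        2 * z.radius i := by
      unfold KnotPartition.radius
      ring
    rcases min_choice (z.pt (i + 1) - z.pt i) (z.pt (i + 1 + 1) - z.pt (i + 1)) with h4 | h4
    · rw [← h4, h3] at h1
      linarith
    · rw [← h4, h3] at h2
      linarith
  have hlen : t.pt (l + 1) - t.pt l ≤ δ / 2 * z.radius i := by
    rcases lt_or_ge x (z.pt (i + 1)) with hlt | hge
    · exact key i (Or.inl rfl) ⟨x, ⟨hxl.1, hxl.2.le⟩, by linarith, hlt⟩
    · have hlt : x < min (t.pt (l + 1)) (z.pt (i + 1 + 1)) := lt_min hxl.2 (by linarith)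
      obtain ⟨y, hy1, hy2⟩ := exists_between hlt
      exact key (i + 1) (Or.inr rfl) ⟨y, ⟨by linarith [hxl.1], (hy2.trans_le (min_le_left _ _)).le⟩,
        by linarith, hy2.trans_le (min_le_right _ _)⟩
  exact ⟨t.pt (l + 1), ⟨l + 1, rfl⟩, hxl.2, by linarith [hxl.1]⟩

/-! ### Gluing the local corrections -/

theorem isPPF_add_truncSpan {m k : ℕ} (t : KnotPartition m) {P : Polynomial ℝ}
    (hP : P.natDegree ≤ k) {v : ℝ → ℝ} (hv : v ∈ truncSpan k (range t.pt)) :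
    IsPPF k t fun x => P.eval x + v x := by
  intro j hj
  have key : ∃ Q : Polynomial ℝ, Q.natDegree ≤ k ∧
      ∀ x ∈ Ioo (t.pt j) (t.pt (j + 1)), v x = Q.eval x := by
    refine truncSpan_induction (M := fun v => ∃ Q : Polynomial ℝ, Q.natDegree ≤ k ∧
      ∀ x ∈ Ioo (t.pt j) (t.pt (j + 1)), v x = Q.eval x) ?_ ?_ ?_ ?_ hv
    · rintro _ ⟨i, rfl⟩
      rcases le_or_gt i j with hij | hij
      · refine ⟨(Polynomial.X - Polynomial.C (t.pt i)) ^ k, ?_, fun x hx => ?_⟩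
        · refine Polynomial.natDegree_pow_le.trans ?_
          rw [Polynomial.natDegree_X_sub_C, mul_one]
        · have : t.pt i ≤ x := (t.pt_mono hij).trans hx.1.le
          simp [truncPow, this]
      · refine ⟨0, by simp, fun x hx => ?_⟩
        have : x < t.pt i := hx.2.trans_le (t.pt_mono hij)
        simp [truncPow, this]
    · exact ⟨0, by simp, by simp⟩
    · rintro f g ⟨Q, hQ, hQf⟩ ⟨R, hR, hRg⟩
      exact ⟨Q + R, (Polynomial.natDegree_add_le Q R).trans (max_le hQ hR), fun x hx => by
        simp [hQf x hx, hRg x hx]⟩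
    · rintro c f ⟨Q, hQ, hQf⟩
      exact ⟨Polynomial.C c * Q, (Polynomial.natDegree_C_mul_le c Q).trans hQ, fun x hx => by
        simp [hQf x hx]⟩
  obtain ⟨Q, hQ, hQv⟩ := key
  exact ⟨P + Q, (Polynomial.natDegree_add_le P Q).trans (max_le hP hQ), fun x hx => by
    simp [hQv x hx]⟩

theorem isSpline_add_truncSpan {m k : ℕ} (t : KnotPartition m) {P : Polynomial ℝ}
    (hP : P.natDegree ≤ k) {v : ℝ → ℝ} (hv : v ∈ truncSpan k (range t.pt)) :
    IsSpline k t fun x => P.eval x + v x := by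
  refine ⟨isPPF_add_truncSpan t hP hv, fun μ hμ => ContDiff.contDiffOn ?_⟩
  obtain ⟨l, rfl⟩ : ∃ l, k = l + 1 := ⟨k - 1, by omega⟩
  refine (contDiff_eval _ P).add ((truncSpan_contDiff hv).of_le ?_)
  exact_mod_cast Nat.le_of_lt_succ hμ

/-- At a fixed point, corrections at knots already passed have become differences of consecutive
pieces and later ones vanish, so the sum turns the first piece into the current one.
`sum_telescope_middle` allows one correction still in progress. -/
theorem sum_telescope {f g : ℕ → ℝ} {l N : ℕ} (hlN : l ≤ N)
    (h1 : ∀ i < l, f i = g (i + 1) - g i) (h2 : ∀ i, l ≤ i → i < N → f i = 0) :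
    g 0 + ∑ i ∈ Finset.range N, f i = g l := by
  rw [← Finset.sum_subset (Finset.range_mono hlN) (fun i hi hi' => h2 i
    (by simpa using hi') (by simpa using hi)),
    Finset.sum_congr rfl (fun i hi => h1 i (by simpa using hi)), Finset.sum_range_sub]
  ring

theorem sum_telescope_middle {f g : ℕ → ℝ} {l N : ℕ} (hlN : l < N)
    (h1 : ∀ i < l, f i = g (i + 1) - g i) (h2 : ∀ i, l < i → i < N → f i = 0) :
    g 0 + ∑ i ∈ Finset.range N, f i = g l + f l := by
  rw [← Finset.sum_subset (Finset.range_mono (Nat.succ_le_of_lt hlN)) (fun i hi hi' => h2 i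
    (by simpa using hi') (by simpa using hi)), Finset.sum_range_succ,
    Finset.sum_congr rfl (fun i hi => h1 i (by simpa using hi)), Finset.sum_range_sub]
  ring

theorem KnotPartition.pos {n : ℕ} (z : KnotPartition n) : 0 < n := by
  rcases Nat.eq_zero_or_pos n with rfl | h
  · have h1 := z.pt_zero
    rw [z.pt_last] at h1
    norm_num at h1
  · exact h

theorem ae_ne (a : ℝ) : ∀ᵐ x : ℝ, x ≠ a := by
  simp [ae_iff]

/-- On the interval around `z_j` the glued function is one of the pieces, plus the local
correction at `z_j` when `z_j` is an interior knot. -/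
theorem glue_eqOn {n : ℕ} (z : KnotPartition n) {P : ℕ → Polynomial ℝ} {V : ℕ → ℝ → ℝ}
    (hleft : ∀ i, i + 1 < n → ∀ x, x ≤ z.pt (i + 1) - z.radius i → V i x = 0)
    (hright : ∀ i, i + 1 < n → ∀ x, z.pt (i + 1) + z.radius i ≤ x →
      V i x = (P (i + 1) - P i).eval x) {x : ℝ} {j : ℕ} (hx : x ∈ z.midInterval j) :
    (j = 0 → (P 0).eval x + (∑ i ∈ Finset.range (n - 1), V i) x = (P 0).eval x) ∧
    (∀ i, i + 1 = j → i + 1 < n → (P 0).eval x + (∑ i ∈ Finset.range (n - 1), V i) x =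
      (P i).eval x + V i x) ∧
    (j = n → (P 0).eval x + (∑ i ∈ Finset.range (n - 1), V i) x = (P (n - 1)).eval x) := by
  have hn := z.pos
  have hr : ∀ i, i + 1 < n → i + 1 < j → V i x = (P (i + 1)).eval x - (P i).eval x :=
    fun i hi hij => by
      rw [hright i hi x (z.midInterval_right hij hx), Polynomial.eval_sub]
  have hl : ∀ i, i + 1 < n → j < i + 1 → V i x = 0 := fun i hi hij =>
    hleft i hi x (z.midInterval_left hij hx)
  rw [Finset.sum_apply]
  refine ⟨fun h => ?_, fun i h hi => ?_, fun h => ?_⟩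
  · exact sum_telescope (g := fun i => (P i).eval x) (l := 0) (by omega) (fun i hi => by omega)
      fun i _ hi => hl i (by omega) (by omega)
  · exact sum_telescope_middle (g := fun i => (P i).eval x) (l := i) (by omega)
      (fun i' hi' => hr i' (by omega) (by omega)) fun i' h1 h2 => hl i' (by omega) (by omega)
  · exact sum_telescope (g := fun i => (P i).eval x) (l := n - 1) (by omega)
      (fun i' hi' => hr i' (by omega) (by omega)) fun i' h1 h2 => by omega

/-- The window and the set on which the difference is large both have length proportional to `a`, so
their ratio, and with it the constant, is independent of the partition. -/
theorem ofReal_bound_le {B b C ρ a e : ℝ} (hB : 0 ≤ B) (hb : 0 < b) (hC : 0 ≤ C) (hρ : 0 < ρ)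
    (ha : 0 < a) (he : 0 ≤ e) :
    ENNReal.ofReal (C * B) * ENNReal.ofReal (2 * a) ^ e =
      ENNReal.ofReal (C / b * (2 / ρ) ^ e) *
        (ENNReal.ofReal (b * B) * ENNReal.ofReal (ρ * a) ^ e) := by
  rw [ENNReal.ofReal_rpow_of_nonneg (by positivity) he,
    ENNReal.ofReal_rpow_of_nonneg (by positivity) he, ← ENNReal.ofReal_mul (by positivity),
    ← ENNReal.ofReal_mul (by positivity), ← ENNReal.ofReal_mul (by positivity)]
  congr 1
  have h : 2 * a = 2 / ρ * (ρ * a) := by field_simp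
  rw [h, Real.mul_rpow (by positivity) (by positivity)]
  field_simp

/-- Shape preserving smoothing of a `q`-monotone piecewise polynomial, for fixed `q ∈ {1, 2}`. -/
theorem exists_smoothing {r : ℕ} (hr : 1 ≤ r) {q : ℕ} (hq : q = 1 ∨ q = 2) :
    ∃ δ : ℝ, 0 < δ ∧ ∃ c : ℝ≥0∞ → ℝ≥0, ∀ (n : ℕ) (z : KnotPartition n) (s : ℝ → ℝ),
      IsPPF (q + r) z s → QMonotoneOn q s (Icc (-1) 1) →
      ∀ (m : ℕ) (t : KnotPartition m), IsRemesh δ z t →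
      ∃ s' : ℝ → ℝ, IsSpline (q + r) t s' ∧ QMonotoneOn q s' (Icc (-1) 1) ∧
        ∀ p : ℝ≥0∞, 0 < p → ∀ j ≤ n,
          lpNorm p (fun x => s x - s' x) (z.midInterval j) ≤
            (c p : ℝ≥0∞) * modulusOn (q + r + 1) s (z.midInterval j) p := by
  obtain ⟨δ, hδ, C, hC, hloc⟩ := exists_local_spline hr hq
  obtain ⟨b, hb, ρ, hρ, hmod⟩ := exists_coeffNorm_le_modulusOn (q + r)
  -- In a window |s - s'| ≤ (C + 1)N: `C` bounds the correction and 1 the jump polynomial itself.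
  -- The exponent 1/p enters only through the length ratio 2/ρ, while s' does not depend on p.
  refine ⟨δ / 4, by positivity,
    fun p => Real.toNNReal ((C + 1) / b * (2 / ρ) ^ (1 / p.toReal)), ?_⟩
  intro n z s hs hmono m t ht
  have hn := z.pos
  choose! P hPdeg hPs using hs
  have hJ : Convex ℝ (Icc (-1 : ℝ) 1) := convex_Icc _ _
  have hsub : ∀ i, Ioo (z.pt i) (z.pt (i + 1)) ⊆ Icc (-1) 1 := fun i x hx =>
    ⟨by linarith [hx.1, z.neg_one_le_pt i], by linarith [hx.2, z.pt_le_one (i + 1)]⟩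
  have hPnonneg : ∀ i < n, ∀ x ∈ Icc (z.pt i) (z.pt (i + 1)),
      0 ≤ (Polynomial.derivative^[q] (P i)).eval x := fun i hi =>
    iterate_derivative_nonneg_of_qMonotoneOn hq hJ hmono (z.pt_lt_succ hi) (hsub i) (hPs i hi)
  have hV : ∀ i, i + 1 < n → ∃ V ∈ truncSpan (q + r)
      (range t.pt ∩ Ioo (z.pt (i + 1) - z.radius i) (z.pt (i + 1) + z.radius i)),
      (∀ x, z.pt (i + 1) + z.radius i ≤ x → V x = (P (i + 1) - P i).eval x) ∧
      (∀ x ∈ Icc (z.pt (i + 1) - z.radius i) (z.pt (i + 1) + z.radius i),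
        |V x| ≤ C * coeffNorm (q + r) (rescale (z.radius i) (z.pt (i + 1)) (P (i + 1) - P i))) ∧
      ∀ x ∈ Icc (z.pt (i + 1) - z.radius i) (z.pt (i + 1) + z.radius i),
        0 ≤ iteratedDeriv q (fun x => (P i).eval x + V x) x := by
    intro i hi
    have ha := z.radius_pos hi
    have hl := z.radius_le_left i
    have hrr := z.radius_le_right i
    refine hloc (range t.pt) (z.radius i) (z.pt (i + 1)) ha
      (fun x h1 h2 => ht.exists_knot hδ hi h1 h2) (P i) (P (i + 1)) (hPdeg i (by omega))
      (hPdeg _ hi) (fun x hx => hPnonneg i (by omega) x ⟨by linarith [hx.1], hx.2⟩)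
      (fun x hx => hPnonneg _ hi x ⟨hx.1, by linarith [hx.2]⟩) ?_
    exact jumpNonneg_of_qMonotoneOn hq hmono (z.neg_one_le_pt i) (by linarith) (by linarith)
      (z.pt_le_one _) (hPs i (by omega)) (hPs _ hi)
  choose! V hVmem hVr hVb hVd using hV
  have hVl : ∀ i, i + 1 < n → ∀ x, x ≤ z.pt (i + 1) - z.radius i → V i x = 0 := fun i hi =>
    truncSpan_eq_zero (inter_Ioo_subset_Ioi _ _ _) (hVmem i hi)
  have hVt : ∀ i, i + 1 < n → V i ∈ truncSpan (q + r) (range t.pt) := fun i hi =>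
    truncSpan_mono inter_subset_left (hVmem i hi)
  -- Degree q + r gives class C^(q+r-1), so r ≥ 1 is what makes the q-th derivative continuous and
  -- lets its sign be checked on open pieces.
  have hcd : ∀ v ∈ truncSpan (q + r) (range t.pt), ContDiff ℝ q v := by
    intro v hv
    obtain ⟨k, rfl⟩ := Nat.exists_eq_add_of_le' hr
    rw [← add_assoc] at hv
    exact (truncSpan_contDiff hv).of_le (by exact_mod_cast Nat.le_add_right q k)
  have hsum : (∑ i ∈ Finset.range (n - 1), V i) ∈ truncSpan (q + r) (range t.pt) :=
    Submodule.sum_mem _ fun i hi => hVt i (by have := Finset.mem_range.1 hi; omega)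
  -- Index i refers to the knot i + 1, so the n - 1 terms correspond to the interior knots.
  set s' : ℝ → ℝ := fun x => (P 0).eval x + (∑ i ∈ Finset.range (n - 1), V i) x with hs'
  have hs'cd : ContDiff ℝ q s' := (contDiff_eval q (P 0)).add (hcd _ hsum)
  have hglue := fun {x : ℝ} {j : ℕ} => glue_eqOn z hVl hVr (x := x) (j := j)
  have hlast : n - 1 + 1 = n := by omega
  -- nonnegativity of the derivative of order `q`, piece by piece
  have hpiece : ∀ i, i + 1 < n → ∀ x ∈ Icc (z.pt i) (z.pt (i + 1 + 1)),
      0 ≤ iteratedDeriv q (fun x => (P i).eval x + V i x) x := by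
    intro i hi x hx
    have ha := z.radius_pos hi
    have hcdi : ContDiff ℝ q fun x => (P i).eval x + V i x :=
      (contDiff_eval q (P i)).add (hcd _ (hVt i hi))
    rcases le_total x (z.pt (i + 1) - z.radius i) with h1 | h1
    · have h := iteratedDeriv_eqOn_closure hcdi (contDiff_eval q (P i)) isOpen_Iio
        (U := Iio (z.pt (i + 1) - z.radius i)) (fun y hy => by
          simp [hVl i hi y (le_of_lt hy)])
      rw [closure_Iio] at h
      rw [h h1, iteratedDeriv_eval]
      exact hPnonneg i (by omega) x ⟨hx.1, by linarith⟩
    · rcases le_total x (z.pt (i + 1) + z.radius i) with h2 | h2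
      · exact hVd i hi x ⟨h1, h2⟩
      · have h := iteratedDeriv_eqOn_closure hcdi (contDiff_eval q (P (i + 1))) isOpen_Ioi
          (U := Ioi (z.pt (i + 1) + z.radius i)) (fun y hy => by
            simp [hVr i hi y (le_of_lt hy)])
        rw [closure_Ioi] at h
        rw [h h2, iteratedDeriv_eval]
        exact hPnonneg _ hi x ⟨by linarith, hx.2⟩
  have hderiv : ∀ x ∈ Icc (-1 : ℝ) 1, 0 ≤ iteratedDeriv q s' x := by
    intro x hx
    obtain ⟨j, hj, hxj⟩ := z.exists_mem_midInterval hx.1 hx.2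
    have hcl : ∀ {g : ℝ → ℝ}, ContDiff ℝ q g → EqOn s' g (z.midInterval j) →
        iteratedDeriv q s' x = iteratedDeriv q g x := by
      intro g hg heq
      have h := iteratedDeriv_eqOn_closure hs'cd hg isOpen_Ioo
        (heq.mono (Ioo_subset_Icc_self :
          Ioo ((z.pt (j - 1) + z.pt j) / 2) ((z.pt j + z.pt (j + 1)) / 2) ⊆ z.midInterval j))
      rw [closure_Ioo (z.midInterval_lt hn hj).ne] at h
      exact h hxj
    have hlo := z.pt_mono (Nat.sub_le j 1)
    have hhi := z.pt_mono (Nat.le_succ j)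
    rcases Nat.eq_zero_or_pos j with rfl | hj0
    · rw [hcl (contDiff_eval q (P 0)) fun y hy => (hglue hy).1 rfl, iteratedDeriv_eval]
      exact hPnonneg 0 hn x ⟨by linarith [hxj.1], by linarith [hxj.2]⟩
    · rcases hj.lt_or_eq with hjn | rfl
      · obtain ⟨i, rfl⟩ : ∃ i, j = i + 1 := ⟨j - 1, by omega⟩
        rw [hcl ((contDiff_eval q (P i)).add (hcd _ (hVt i hjn)))
          fun y hy => (hglue hy).2.1 i rfl hjn]
        rw [Nat.add_sub_cancel] at hlo
        have h1 := hxj.1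
        rw [Nat.add_sub_cancel] at h1
        exact hpiece i hjn x ⟨by linarith, by linarith [hxj.2]⟩
      · rw [hcl (contDiff_eval q (P (j - 1))) fun y hy => (hglue hy).2.2 rfl,
          iteratedDeriv_eval]
        refine hPnonneg (j - 1) (by omega) x ⟨by linarith [hxj.1], ?_⟩
        rw [hlast, z.pt_last]
        exact hx.2
  refine ⟨s', isSpline_add_truncSpan t (hPdeg 0 hn) hsum,
    qMonotoneOn_of_iteratedDeriv_nonneg hq hs'cd hderiv, fun p hp j hj => ?_⟩
  have hzero : (∀ᵐ x, x ∈ z.midInterval j → s x - s' x = 0) →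
      lpNorm p (fun x => s x - s' x) (z.midInterval j) = 0 := fun h => by
    unfold lpNorm
    have h2 := (ae_restrict_iff' (z.measurableSet_midInterval j)).2 h
    rw [eLpNorm_congr_ae h2]
    exact eLpNorm_zero'
  have hlo := z.pt_mono (Nat.sub_le j 1)
  have hhi := z.pt_mono (Nat.le_succ j)
  -- On the first and last mid-intervals no correction is active: s and s' agree there except
  -- possibly at the end knot, where s need not equal its polynomial piece. The error norm is then
  -- zero.
  rcases Nat.eq_zero_or_pos j with rfl | hj0
  · rw [hzero]
    · exact zero_le
    · filter_upwards [ae_ne (z.pt 0)] with x hx0 hx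
      have h1 : s' x = (P 0).eval x := (hglue hx).1 rfl
      have h2 := z.pt_lt_succ hn
      have h3 : z.pt 0 < x := lt_of_le_of_ne (by linarith [hx.1]) hx0.symm
      rw [h1, hPs 0 hn x ⟨h3, by linarith [hx.2]⟩, sub_self]
  rcases hj.lt_or_eq with hjn | rfl
  · obtain ⟨i, rfl⟩ : ∃ i, j = i + 1 := ⟨j - 1, by omega⟩
    have ha := z.radius_pos hjn
    have hl := z.radius_le_left i
    have hrr := z.radius_le_right i
    set Z := z.pt (i + 1) with hZ
    set a := z.radius i with ha'
    set N := coeffNorm (q + r) (rescale a Z (P (i + 1) - P i)) with hN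
    have hN0 : 0 ≤ N := coeffNorm_nonneg _ _
    have hform : ∀ x ∈ z.midInterval (i + 1), s' x = (P i).eval x + V i x := fun x hx =>
      (hglue hx).2.1 i rfl hjn
    have hJx : ∀ x ∈ z.midInterval (i + 1), z.pt i < x ∧ x < z.pt (i + 1 + 1) := fun x hx => by
      have h1 := hx.1
      have h2 := hx.2
      rw [Nat.add_sub_cancel, ← hZ] at h1
      rw [← hZ] at h2
      exact ⟨by linarith, by linarith⟩
    have hsl : ∀ x ∈ z.midInterval (i + 1), x < Z → s x = (P i).eval x := fun x hx h =>
      hPs i (by omega) x ⟨(hJx x hx).1, h⟩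
    have hsr : ∀ x ∈ z.midInterval (i + 1), Z < x → s x = (P (i + 1)).eval x := fun x hx h =>
      hPs (i + 1) hjn x ⟨h, (hJx x hx).2⟩
    have hdN : ∀ x ∈ Icc (Z - a) (Z + a), |(P (i + 1) - P i).eval x| ≤ N := fun x hx => by
      have h := abs_eval_le_coeffNorm (rescale_natDegree_le a Z
        ((Polynomial.natDegree_sub_le (P (i + 1)) (P i)).trans
          (max_le (hPdeg _ hjn) (hPdeg i (by omega))))) (x := (x - Z) / a)
          (abs_le.2 ⟨by rw [le_div_iff₀ ha]; linarith [hx.1],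
            by rw [div_le_iff₀ ha]; linarith [hx.2]⟩)
      rw [rescale_eval, mul_div_cancel₀ _ ha.ne', add_sub_cancel] at h
      exact h
    have hup := lpNorm_le_of_bound (f := fun x => s x - s' x) (J := z.midInterval (i + 1)) (z := Z)
      (a := a) (B := (C + 1) * N) (by positivity) (by
        filter_upwards [ae_ne Z] with x hxZ hx hxI
        have hb1 := hVb i hjn x hxI
        rw [hform x hx]
        rcases lt_or_gt_of_ne hxZ with h | h
        · rw [hsl x hx h, sub_add_cancel_left, abs_neg]
          linarith
        · have e : (P (i + 1)).eval x - ((P i).eval x + V i x) =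
              (P (i + 1) - P i).eval x - V i x := by
            rw [Polynomial.eval_sub]
            ring
          rw [hsr x hx h, e]
          exact (abs_sub _ _).trans (by linarith [hdN x hxI])) (by
        refine Filter.Eventually.of_forall fun x hx hxI => ?_
        rw [hform x hx]
        rcases lt_or_ge x (Z - a) with h | h
        · rw [hsl x hx (by linarith), hVl i hjn x h.le]
          ring
        · have h' : Z + a < x := by
            by_contra hcon
            exact hxI ⟨h, not_lt.1 hcon⟩
          rw [hsr x hx (by linarith), hVr i hjn x h'.le, Polynomial.eval_sub]
          ring) (z.measurableSet_midInterval _) p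
    refine hup.trans ?_
    have hlow := hmod s (P i) (P (i + 1)) (hPdeg i (by omega)) (hPdeg _ hjn) Z a
      ((z.pt (i + 1 - 1) + z.pt (i + 1)) / 2) ((z.pt (i + 1) + z.pt (i + 1 + 1)) / 2) ha
      (by rw [Nat.add_sub_cancel, ← hZ]; linarith) (by rw [← hZ]; linarith)
      (fun x hx => hPs i (by omega) x ⟨by linarith [hx.1], hx.2⟩)
      (fun x hx => hPs (i + 1) hjn x ⟨hx.1, by linarith [hx.2]⟩) p hp
    rw [ofReal_bound_le hN0 hb (by positivity) hρ ha (by positivity)]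
    exact mul_le_mul_right hlow _
  · rw [hzero]
    · exact zero_le
    · filter_upwards [ae_ne (z.pt j)] with x hx0 hx
      have h1 : s' x = (P (j - 1)).eval x := (hglue hx).2.2 rfl
      have h2 := z.pt_lt_succ (show j - 1 < j by omega)
      rw [hlast] at h2
      have h4 := hx.2
      rw [z.pt_of_le (Nat.le_succ j), z.pt_last] at h4
      have h3 : x < z.pt j := lt_of_le_of_ne (by rw [z.pt_last]; linarith) hx0
      rw [h1, hPs (j - 1) (by omega) x ⟨by linarith [hx.1], by rwa [hlast]⟩, sub_self]

theorem IsRemesh.mono {n m : ℕ} {δ δ' : ℝ} (h : δ ≤ δ') {z : KnotPartition n}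
    {t : KnotPartition m} (ht : IsRemesh δ z t) : IsRemesh δ' z t :=
  fun j hj i hi hne ν hν h1 h2 => (ht j hj i hi hne ν hν h1 h2).trans
    (mul_le_mul_of_nonneg_right h (abs_nonneg _))

end SplineSmoothing

theorem theorem1p2 (r : ℕ) (hr : 1 ≤ r) :
    ∃ δ : ℝ, 0 < δ ∧ ∃ c : ℝ≥0∞ → ℝ≥0,
      ∀ q : ℕ, (q = 1 ∨ q = 2) →
      ∀ (n : ℕ) (z : SplineSmoothing.KnotPartition n) (s : ℝ → ℝ),
        SplineSmoothing.IsPPF (q + r) z s →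
        SplineSmoothing.QMonotoneOn q s (Icc (-1) 1) →
      ∀ (m : ℕ) (t : SplineSmoothing.KnotPartition m), SplineSmoothing.IsRemesh δ z t →
      ∃ s' : ℝ → ℝ,
        SplineSmoothing.IsSpline (q + r) t s' ∧
        SplineSmoothing.QMonotoneOn q s' (Icc (-1) 1) ∧
        ∀ p : ℝ≥0∞, 0 < p → ∀ j ≤ n,
          SplineSmoothing.lpNorm p (fun x => s x - s' x) (z.midInterval j) ≤
            (c p : ℝ≥0∞) * SplineSmoothing.modulusOn (q + r + 1) s (z.midInterval j) p := by
  obtain ⟨δ₁, hδ₁, c₁, h₁⟩ := SplineSmoothing.exists_smoothing hr (q := 1) (Or.inl rfl)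
  obtain ⟨δ₂, hδ₂, c₂, h₂⟩ := SplineSmoothing.exists_smoothing hr (q := 2) (Or.inr rfl)
  refine ⟨min δ₁ δ₂, lt_min hδ₁ hδ₂, fun p => max (c₁ p) (c₂ p), ?_⟩
  rintro q (rfl | rfl) n z s hs hmono m t ht
  · obtain ⟨s', hs', hs'm, hle⟩ := h₁ n z s hs hmono m t (ht.mono (min_le_left _ _))
    refine ⟨s', hs', hs'm, fun p hp j hj => (hle p hp j hj).trans ?_⟩
    gcongr
    exact le_max_left _ _
  · obtain ⟨s', hs', hs'm, hle⟩ := h₂ n z s hs hmono m t (ht.mono (min_le_right _ _))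
    refine ⟨s', hs', hs'm, fun p hp j hj => (hle p hp j hj).trans ?_⟩
    gcongr
    exact le_max_right _ _
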